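/- Let $A$ be a finite alphabet, let $X=A^{\mathbb Z^2}$ carry the product topology and product $\sigma$-algebra, and let $\sigma_1,\sigma_2$ be the horizontal and vertical shifts, $(\sigma_1x)_{(i,j)}=x_{(i+1,j)}$, $(\sigma_2x)_{(i,j)}=x_{(i,j+1)}$. Let $F:X\to X$ be a two-dimensional cellular automaton, that is, a continuous map commuting with $\sigma_1$ and $\sigma_2$, and let $\mu$ be an $F$-invariant probability measure on $X$ that is invariant and ergodic for the $\mathbb Z^2$-action generated by $\sigma_1,\sigma_2$. For a finite measurable partition $\alpha$ put $H_\mu(\alpha)=-\sum_{B\in\alpha}\mu(B)\log\mu(B)$, $$h_\mu(F,\alpha)=\lim_{m\to\infty}\tfrac1m H_\mu\Big(\bigvee_{k=0}^{m-1}F^{-k}\alpha\Big),\qquad h_\mu(\sigma_1,\sigma_2,\alpha)=\lim_{n\to\infty}\tfrac1{n^2}H_\mu\Big(\bigvee_{0\le i,j<n}\sigma_1^{-i}\sigma_2^{-j}\alpha\Big),$$ and let $h_\mu(\sigma_1,\sigma_2)=\sup_\alpha h_\mu(\sigma_1,\sigma_2,\alpha)$. Let $\alpha_n$ be the partition of $X$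 according to the coordinates $(i,j)$ with $0\le i,j\le n$, let $\alpha_*$ be the partition according to the coordinate $(0,0)$, and define the always finite entropy $$h^{2D}_\mu(F)=\liminf_{n\to\infty}\tfrac1n h_\mu(F,\alpha_n).$$ For $\theta\in\mathbb R$ and $p=(i,j)\in\mathbb Z^2$ let $W^\theta_p\subset\mathbb Z^2$ be the lattice half plane $$W^\theta_p=\{(\lfloor s\rfloor,\lfloor t\rfloor): s,t\in\mathbb R,\ s\cos\theta+t\sin\theta\le i\cos\theta+j\sin\theta\},$$ and let $W^\theta_p(x)$ be the set of $y\in X$ that agree with $x$ on $W^\theta_p$. Put $$\Lambda_n^F(\theta)(x)=\min\Big\{\sqrt{i^2+j^2}: p=(i,j)\in\mathbb Z^2,\ i\cos\theta+j\sin\theta\ge0,\ F^k(W^\theta_p(x))\subset W^\theta_{(0,0)}(F^k x)\ \text{for all } 1\le k\le n\Big\},$$ $\Lambda_n^F(\theta)=\max_{x\in X}\Lambda_n^F(\theta)(x)$ and $\lambda(\theta)=\lim_{n\to\infty}\Lambda_n^F(\theta)/n$ (the directional Lyapunov exponent in direction $\theta$). Then all these limits, minima and maxima exist, $\lambda$ is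 continuous, and $$h^{2D}_\mu(F)\le h_\mu(\sigma_1,\sigma_2)\left(\int_0^{2\pi}\frac{\lambda(\theta)^2}{2}\,d\theta+\sqrt2\int_0^{\pi}\lambda(\theta)\,d\theta+\pi\right);$$ the same inequality holds with $h_\mu(\sigma_1,\sigma_2,\alpha_*)$ in place of $h_\mu(\sigma_1,\sigma_2)$, and in particular $h^{2D}_\mu(F)<\infty$. -/

import Mathlib

open Filter Topology MeasureTheory

noncomputable section

namespace CA2D

/-- Configurations of the two-dimensional lattice over the alphabet `A`, with the product
topology and the product sigma-algebra. -/
abbrev Config (A : Type*) := ℤ × ℤ → A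

/-- Horizontal shift. -/
def shift₁ {A : Type*} (x : Config A) : Config A := fun p => x (p.1 + 1, p.2)

/-- Vertical shift. -/
def shift₂ {A : Type*} (x : Config A) : Config A := fun p => x (p.1, p.2 + 1)

/-- A two-dimensional cellular automaton: a continuous self-map commuting with both shifts. -/
structure IsCellularAutomaton {A : Type*} [TopologicalSpace A] (F : Config A → Config A) :
    Prop where
  continuous : Continuous F
  comm₁ : ∀ x, F (shift₁ x) = shift₁ (F x)
  comm₂ : ∀ x, F (shift₂ x) = shift₂ (F x)

/-- `μ` is invariant and ergodic for the action of `ℤ²` generated by the two shifts. -/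
structure IsShiftErgodic {A : Type*} [MeasurableSpace A] (μ : Measure (Config A)) : Prop where
  measurePreserving₁ : MeasurePreserving (shift₁ (A := A)) μ μ
  measurePreserving₂ : MeasurePreserving (shift₂ (A := A)) μ μ
  ergodic : ∀ B : Set (Config A), MeasurableSet B →
    shift₁ ⁻¹' B = B → shift₂ ⁻¹' B = B → μ B = 0 ∨ μ B = 1

/-! ### Entropies

A finite partition is given by a map `f` into a finite type, its atoms being the fibres of `f`;
the join of a finite family of partitions is given by the tuple of the maps. -/

/-- `H_μ(α) = - ∑ μ(B) log μ(B)` for the partition `α` into the fibres of `f`. -/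
def partitionEntropy {X ι : Type*} [MeasurableSpace X] [Fintype ι] (μ : Measure X) (f : X → ι) :
    ℝ :=
  ∑ b : ι, Real.negMulLog (μ.real (f ⁻¹' {b}))

/-- `(1/m) H_μ(α ∨ T⁻¹α ∨ ⋯ ∨ T^{-(m-1)}α)`. -/
def entropySeq {X ι : Type*} [MeasurableSpace X] [Fintype ι] (μ : Measure X) (T : X → X)
    (f : X → ι) (m : ℕ) : ℝ :=
  partitionEntropy μ (fun x (k : Fin m) => f (T^[(k : ℕ)] x)) / m

/-- `h_μ(T, α)`. -/
def entropyOf {X ι : Type*} [MeasurableSpace X] [Fintype ι] (μ : Measure X) (T : X → X)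
    (f : X → ι) : ℝ :=
  limUnder atTop (entropySeq μ T f)

/-- The partition `α_n` into the cylinders fixing the coordinates `(i,j)`, `0 ≤ i, j ≤ n`. -/
def squarePartition {A : Type*} (n : ℕ) (x : Config A) : Fin (n + 1) × Fin (n + 1) → A :=
  fun q => x (((q.1 : ℕ) : ℤ), ((q.2 : ℕ) : ℤ))

/-- The always finite entropy `h^{2D}_μ(F) = liminf (1/n) h_μ(F, α_n)`, as an extended real. -/
def alwaysFiniteEntropy {A : Type*} [Fintype A] [MeasurableSpace A] (μ : Measure (Config A))
    (F : Config A → Config A) : EReal :=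
  liminf (fun n : ℕ => ((entropyOf μ F (squarePartition n) / n : ℝ) : EReal)) atTop

/-- `(1/n²) H_μ(⋁_{0 ≤ i, j < n} σ₁^{-i} σ₂^{-j} α)`. -/
def shiftEntropySeq {A ι : Type*} [MeasurableSpace A] [Fintype ι] (μ : Measure (Config A))
    (f : Config A → ι) (n : ℕ) : ℝ :=
  partitionEntropy μ
    (fun x (q : Fin n × Fin n) => f (shift₁^[(q.1 : ℕ)] (shift₂^[(q.2 : ℕ)] x))) / (n : ℝ) ^ 2

/-- `h_μ(σ₁, σ₂, α)`. -/
def shiftEntropyOf {A ι : Type*} [MeasurableSpace A] [Fintype ι] (μ : Measure (Config A))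
    (f : Config A → ι) : ℝ :=
  limUnder atTop (shiftEntropySeq μ f)

/-- The entropy `h_μ(σ₁, σ₂)` of the `ℤ²`-action: the supremum of `h_μ(σ₁, σ₂, α)` over all
finite measurable partitions `α`. -/
def shiftEntropy {A : Type*} [MeasurableSpace A] (μ : Measure (Config A)) : EReal :=
  ⨆ (m : ℕ) (f : {f : Config A → Fin m // Measurable f}), ((shiftEntropyOf μ f.1 : ℝ) : EReal)

/-- The partition `α_1` by the central coordinate. -/
def centralPartition {A : Type*} (x : Config A) : A := x (0, 0)

/-! ### Directional Lyapunov exponents -/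

/-- The lattice half plane `W^θ_p`: the integer parts `(⌊s⌋, ⌊t⌋)` of the points `(s, t)` of the
closed real half plane that is bounded by the line through `p` making the angle `θ` with the
vertical, and that has outer normal `(cos θ, sin θ)`. Its boundary is the almost line through `p`,
that is, the set of integer parts of the points of the real line. -/
def halfPlane (θ : ℝ) (p : ℤ × ℤ) : Set (ℤ × ℤ) :=
  {q | ∃ s t : ℝ, s * Real.cos θ + t * Real.sin θ ≤ p.1 * Real.cos θ + p.2 * Real.sin θ ∧
    q = (⌊s⌋, ⌊t⌋)}

/-- `W^θ_p(x)`: the configurations that agree with `x` on `W^θ_p`. -/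
def agreeSet {A : Type*} (θ : ℝ) (p : ℤ × ℤ) (x : Config A) : Set (Config A) :=
  {y | ∀ q ∈ halfPlane θ p, y q = x q}

/-- The values `s = √(i² + j²)`, for `(i,j)` such that the half plane bounded by the line
through `(i,j)` contains the origin and `F^k(W^θ_{(i,j)}(x)) ⊆ W^θ_{(0,0)}(F^k x)` for all
`1 ≤ k ≤ n`. -/
def propagationRadii {A : Type*} (F : Config A → Config A) (n : ℕ) (θ : ℝ) (x : Config A) :
    Set ℝ :=
  {s | ∃ p : ℤ × ℤ, 0 ≤ p.1 * Real.cos θ + p.2 * Real.sin θ ∧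
    s = Real.sqrt ((p.1 : ℝ) ^ 2 + (p.2 : ℝ) ^ 2) ∧
    ∀ k : ℕ, 1 ≤ k → k ≤ n → F^[k] '' agreeSet θ p x ⊆ agreeSet θ (0, 0) (F^[k] x)}

/-- `Λ_n^F(θ)(x)`, the minimum of `propagationRadii F n θ x`. -/
def propagationAt {A : Type*} (F : Config A → Config A) (n : ℕ) (θ : ℝ) (x : Config A) : ℝ :=
  sInf (propagationRadii F n θ x)

/-- `Λ_n^F(θ)`, the maximum over all configurations `x` of `Λ_n^F(θ)(x)`. -/
def propagation {A : Type*} (F : Config A → Config A) (n : ℕ) (θ : ℝ) : ℝ :=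
  sSup (Set.range (propagationAt F n θ))

/-- The directional Lyapunov exponent `λ(θ) = lim Λ_n^F(θ) / n`. -/
def lyapunov {A : Type*} (F : Config A → Config A) (θ : ℝ) : ℝ :=
  limUnder atTop (fun n : ℕ => propagation F n θ / n)

/-- `∫_0^{2π} λ(θ)²/2 dθ + √2 ∫_0^π λ(θ) dθ + π`. -/
def lyapunovBound {A : Type*} (F : Config A → Config A) : ℝ :=
  (∫ θ in (0 : ℝ)..(2 * Real.pi), lyapunov F θ ^ 2 / 2) +
    Real.sqrt 2 * (∫ θ in (0 : ℝ)..Real.pi, lyapunov F θ) + Real.pi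

end CA2D

end

/-! Put w = λ(0) + λ(π) and h = λ(π/2) + λ(3π/2). The inequality splits at the constant 2(w + h):
the entropy is at most 2(w + h) h_μ(σ₁, σ₂, α_*), and 2(w + h) is at most the integral expression
`lyapunovBound`.

Entropy. Each of the four axis directions confines the coordinates read by the local rules of F, …,
F^m to a half plane. A function that depends on two sets of coordinates depends on their
intersection (`DependsOn.inter`), so the rules read a box with sides about wm and hm
(`exists_dependsOn_rect`). Hence the join of the F^{-k} α_n, k < m, is coarser than a rectangle of
coordinates with sides about n + wm and n + hm. Rectangle entropy is asymptotically at most area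
times h_μ(σ₁, σ₂, α_*) (`rectEntropy_le`), and dividing by nm with m ≈ n/w leaves 2n(n + hn/w)w/n² =
2(w + h) (`alwaysFiniteEntropy_le_of_lt`).

Exponents. Up to bounded errors, Λ_n(θ) is the nonnegative part of the support function, in
direction θ, of the coordinates read by the rules of F, …, F^n. So λ inherits 2 cos t · λ(φ) ≤ λ(φ +
t) + λ(φ - t) (`two_cos_mul_lyapunov_le`). Integrating over |t| ≤ π/4 at the four axis directions,
whose arcs tile the circle, gives √2 (w + h) ≤ ∫ λ over the circle. Finally √2 λ - 1 ≤ λ²/2, used on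
[π, 2π] only, gives √2 ∫ λ ≤ `lyapunovBound`. -/

namespace CA2D

/-! ### Entropy of finite partitions -/

section Entropy

variable {X ι κ : Type*} [MeasurableSpace X]

/-- The fibres of `f` are measurable. -/
def MeasurableFibers (f : X → ι) : Prop := ∀ b, MeasurableSet (f ⁻¹' {b})

theorem MeasurableFibers.comp {f : X → ι} (hf : MeasurableFibers f) {T : X → X}
    (hT : Measurable T) : MeasurableFibers (fun x => f (T x)) :=
  fun b => hT (hf b)

theorem MeasurableFibers.pi {S : Type*} [Finite S] {f : S → X → ι}
    (hf : ∀ s, MeasurableFibers (f s)) : MeasurableFibers (fun x s => f s x) := by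
  intro b
  have : (fun x s => f s x) ⁻¹' {b} = ⋂ s, f s ⁻¹' {b s} := by
    ext x; simp [funext_iff]
  rw [this]
  exact MeasurableSet.iInter fun s => hf s (b s)

theorem MeasurableFibers.prodMk {f : X → ι} {g : X → κ} (hf : MeasurableFibers f)
    (hg : MeasurableFibers g) : MeasurableFibers (fun x => (f x, g x)) := by
  rintro ⟨b, c⟩
  have : (fun x => (f x, g x)) ⁻¹' {(b, c)} = f ⁻¹' {b} ∩ g ⁻¹' {c} := by
    ext x; simp
  rw [this]
  exact (hf b).inter (hg c)

/-- Weighted by `p c`, each logarithm `log (p c)` is at most the logarithm of the whole sum. -/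
theorem negMulLog_sum_le (s : Finset κ) (p : κ → ℝ) (hp : ∀ c ∈ s, 0 ≤ p c) :
    Real.negMulLog (∑ c ∈ s, p c) ≤ ∑ c ∈ s, Real.negMulLog (p c) := by
  rw [Real.negMulLog, neg_mul, Finset.sum_mul, ← Finset.sum_neg_distrib]
  refine Finset.sum_le_sum fun c hc => ?_
  rw [Real.negMulLog, neg_mul, neg_le_neg_iff]
  rcases (hp c hc).eq_or_lt with h | h
  · simp [← h]
  · exact mul_le_mul_of_nonneg_left
      (Real.log_le_log h (Finset.single_le_sum hp hc)) h.le

variable [Fintype ι] [Fintype κ] (μ : Measure X)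

theorem partitionEntropy_comp_eq {f : X → ι} (hf : MeasurableFibers f) {T : X → X}
    (hT : MeasurePreserving T μ μ) :
    partitionEntropy μ (fun x => f (T x)) = partitionEntropy μ f := by
  unfold partitionEntropy
  refine Finset.sum_congr rfl fun b _ => ?_
  rw [← hT.measureReal_preimage (hf b).nullMeasurableSet]
  rfl

variable [IsProbabilityMeasure μ]

theorem sum_measureReal_fibers {f : X → ι} (hf : MeasurableFibers f) :
    ∑ b, μ.real (f ⁻¹' {b}) = 1 := by
  rw [sum_measureReal_preimage_singleton _ fun b _ => hf b]
  simp

theorem partitionEntropy_nonneg (f : X → ι) : 0 ≤ partitionEntropy μ f :=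
  Finset.sum_nonneg fun _ _ => Real.negMulLog_nonneg measureReal_nonneg measureReal_le_one

theorem partitionEntropy_mono {f : X → ι} {g : X → κ} (hg : MeasurableFibers g)
    (h : ∀ x y, g x = g y → f x = f y) : partitionEntropy μ f ≤ partitionEntropy μ g := by
  classical
  have hX : Nonempty X := nonempty_of_isProbabilityMeasure μ
  have : Nonempty ι := hX.map f
  obtain ⟨e, rfl⟩ := (Function.factorsThrough_iff (f := g) f).1 fun x y => h x y
  unfold partitionEntropy
  have key : ∀ b, μ.real (e ∘ g ⁻¹' {b}) =
      ∑ c ∈ Finset.univ.filter (fun c => e c = b), μ.real (g ⁻¹' {c}) := by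
    intro b
    rw [sum_measureReal_preimage_singleton _ fun c _ => hg c]
    congr 1
    ext x
    simp
  calc ∑ b, Real.negMulLog (μ.real (e ∘ g ⁻¹' {b}))
      ≤ ∑ b, ∑ c ∈ Finset.univ.filter (fun c => e c = b),
          Real.negMulLog (μ.real (g ⁻¹' {c})) := by
        refine Finset.sum_le_sum fun b _ => ?_
        rw [key]
        exact negMulLog_sum_le _ _ fun _ _ => measureReal_nonneg
    _ = _ := Finset.sum_fiberwise _ _ _

theorem partitionEntropy_congr {f : X → ι} {g : X → κ} (hf : MeasurableFibers f)
    (hg : MeasurableFibers g) (h : ∀ x y, g x = g y ↔ f x = f y) :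
    partitionEntropy μ f = partitionEntropy μ g :=
  le_antisymm (partitionEntropy_mono μ hg fun x y => (h x y).1)
    (partitionEntropy_mono μ hf fun x y => (h x y).2)

/-- Gibbs' inequality: log t ≤ t - 1 at t = p r / P compares the joint law P with the product of its
marginals p and r. The corrections p r - P sum to 1 - 1 = 0. -/
theorem partitionEntropy_prodMk_le {f : X → ι} {g : X → κ} (hf : MeasurableFibers f)
    (hg : MeasurableFibers g) :
    partitionEntropy μ (fun x => (f x, g x)) ≤ partitionEntropy μ f + partitionEntropy μ g := by
  classical
  set P : ι × κ → ℝ := fun q => μ.real ((fun x => (f x, g x)) ⁻¹' {q}) with hP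
  have hfg := hf.prodMk hg
  have hP0 : ∀ q, 0 ≤ P q := fun q => measureReal_nonneg
  have hl : ∀ b, μ.real (f ⁻¹' {b}) = ∑ c, P (b, c) := by
    intro b
    have := sum_measureReal_preimage_singleton (μ := μ) ({b} ×ˢ (Finset.univ : Finset κ))
      fun q _ => hfg q
    rw [Finset.sum_product, Finset.sum_singleton] at this
    rw [hP, this]
    congr 1
    ext x
    simp [eq_comm]
  have hr : ∀ c, μ.real (g ⁻¹' {c}) = ∑ b, P (b, c) := by
    intro c
    have := sum_measureReal_preimage_singleton (μ := μ) ((Finset.univ : Finset ι) ×ˢ {c})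
      fun q _ => hfg q
    rw [Finset.sum_product_right, Finset.sum_singleton] at this
    rw [hP, this]
    congr 1
    ext x
    simp [eq_comm]
  have hP1 : ∑ q, P q = 1 := sum_measureReal_fibers μ hfg
  set p : ι → ℝ := fun b => μ.real (f ⁻¹' {b}) with hp
  set r : κ → ℝ := fun c => μ.real (g ⁻¹' {c}) with hrr
  have hp1 : ∑ b, p b = 1 := sum_measureReal_fibers μ hf
  have hr1 : ∑ c, r c = 1 := sum_measureReal_fibers μ hg
  have key : ∀ q : ι × κ, Real.negMulLog (P q) ≤
      -(P q * Real.log (p q.1)) - P q * Real.log (r q.2) + (p q.1 * r q.2 - P q) := by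
    rintro ⟨b, c⟩
    rcases (hP0 (b, c)).eq_or_lt with h | h
    · rw [← h]
      simpa using mul_nonneg (measureReal_nonneg (μ := μ) (s := f ⁻¹' {b}))
        (measureReal_nonneg (μ := μ) (s := g ⁻¹' {c}))
    · have hpb : 0 < p b := h.trans_le <| by
        rw [hp]; simp only [hl]
        exact Finset.single_le_sum (f := fun c => P (b, c)) (fun _ _ => hP0 _)
          (Finset.mem_univ c)
      have hrc : 0 < r c := h.trans_le <| by
        rw [hrr]; simp only [hr]
        exact Finset.single_le_sum (f := fun b => P (b, c)) (fun _ _ => hP0 _)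
          (Finset.mem_univ b)
      have hlog := Real.log_le_sub_one_of_pos (div_pos (mul_pos hpb hrc) h)
      rw [Real.log_div (mul_pos hpb hrc).ne' h.ne', Real.log_mul hpb.ne' hrc.ne'] at hlog
      have h2 := mul_le_mul_of_nonneg_left hlog h.le
      have h3 : P (b, c) * (p b * r c / P (b, c) - 1) = p b * r c - P (b, c) := by
        field_simp
      rw [h3] at h2
      simp only [Real.negMulLog]
      linarith
  have e1 : ∑ q : ι × κ, P q * Real.log (p q.1) = ∑ b, p b * Real.log (p b) := by
    rw [Fintype.sum_prod_type]
    refine Finset.sum_congr rfl fun b _ => ?_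
    simp only
    rw [← Finset.sum_mul, ← hl]
  have e2 : ∑ q : ι × κ, P q * Real.log (r q.2) = ∑ c, r c * Real.log (r c) := by
    rw [Fintype.sum_prod_type_right]
    refine Finset.sum_congr rfl fun c _ => ?_
    simp only
    rw [← Finset.sum_mul, ← hr]
  have e3 : ∑ q : ι × κ, p q.1 * r q.2 = 1 := by
    rw [Fintype.sum_prod_type]
    simp only [← Finset.mul_sum]
    rw [hr1]
    simpa using hp1
  calc partitionEntropy μ (fun x => (f x, g x)) = ∑ q, Real.negMulLog (P q) := rfl
    _ ≤ ∑ q, (-(P q * Real.log (p q.1)) - P q * Real.log (r q.2) + (p q.1 * r q.2 - P q)) :=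
        Finset.sum_le_sum fun q _ => key q
    _ = -∑ b, p b * Real.log (p b) - ∑ c, r c * Real.log (r c) := by
        rw [Finset.sum_add_distrib, Finset.sum_sub_distrib, Finset.sum_sub_distrib,
          Finset.sum_neg_distrib, e1, e2, e3, hP1]
        ring
    _ = partitionEntropy μ f + partitionEntropy μ g := by
        simp only [partitionEntropy, Real.negMulLog, neg_mul, Finset.sum_neg_distrib, hp, hrr]
        ring

theorem partitionEntropy_le_add {ν : Type*} [Fintype ν] {f : X → ι} {g : X → κ} {k : X → ν}
    (hf : MeasurableFibers f) (hg : MeasurableFibers g)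
    (h : ∀ x y, f x = f y → g x = g y → k x = k y) :
    partitionEntropy μ k ≤ partitionEntropy μ f + partitionEntropy μ g :=
  (partitionEntropy_mono μ (hf.prodMk hg) fun x y hxy =>
    h x y (congrArg Prod.fst hxy) (congrArg Prod.snd hxy)).trans
    (partitionEntropy_prodMk_le μ hf hg)

/-! ### Entropy of a single transformation -/

variable {μ}

theorem subadditive_partitionEntropy_iterate {T : X → X} (hT : MeasurePreserving T μ μ)
    {f : X → ι} (hf : MeasurableFibers f) :
    Subadditive fun m => partitionEntropy μ (fun x (k : Fin m) => f (T^[(k : ℕ)] x)) := by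
  have hm : ∀ m, MeasurableFibers (fun x (k : Fin m) => f (T^[(k : ℕ)] x)) := fun m =>
    MeasurableFibers.pi fun k : Fin m => hf.comp (hT.measurable.iterate (k : ℕ))
  intro m n
  simp only
  rw [← partitionEntropy_comp_eq μ (hm n) (hT.iterate m)]
  refine partitionEntropy_le_add μ (hm m) ((hm n).comp (hT.measurable.iterate m)) ?_
  intro x y h1 h2
  funext k
  rcases lt_or_ge (k : ℕ) m with hk | hk
  · exact congrFun h1 ⟨k, hk⟩
  · have := congrFun h2 ⟨k - m, by omega⟩
    simp only [← Function.iterate_add_apply] at this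
    rwa [show (k : ℕ) - m + m = k by omega] at this

theorem bddBelow_entropySeq (T : X → X) (f : X → ι) :
    BddBelow (Set.range (entropySeq μ T f)) :=
  ⟨0, by rintro _ ⟨m, rfl⟩; exact div_nonneg (partitionEntropy_nonneg μ _) m.cast_nonneg⟩

theorem tendsto_entropySeq {T : X → X} (hT : MeasurePreserving T μ μ) {f : X → ι}
    (hf : MeasurableFibers f) :
    Tendsto (entropySeq μ T f) atTop (𝓝 (entropyOf μ T f)) :=
  tendsto_nhds_limUnder
    ⟨_, (subadditive_partitionEntropy_iterate hT hf).tendsto_lim (bddBelow_entropySeq T f)⟩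

theorem entropyOf_le_entropySeq {T : X → X} (hT : MeasurePreserving T μ μ) {f : X → ι}
    (hf : MeasurableFibers f) {m : ℕ} (hm : m ≠ 0) :
    entropyOf μ T f ≤ entropySeq μ T f m := by
  have h := subadditive_partitionEntropy_iterate hT hf
  rw [show entropyOf μ T f = h.lim from (h.tendsto_lim (bddBelow_entropySeq T f)).limUnder_eq]
  exact h.lim_le_div (bddBelow_entropySeq T f) hm

end Entropy

/-! ### Entropy of the shift action -/

section Shift

variable {A ι : Type*}

/-- Translation of a configuration by a vector. -/
def translate (v : ℤ × ℤ) (x : Config A) : Config A := fun p => x (p + v)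

theorem translate_translate (v w : ℤ × ℤ) (x : Config A) :
    translate v (translate w x) = translate (v + w) x := by
  funext p
  simp [translate, add_assoc]

theorem translate_zero (x : Config A) : translate 0 x = x := by
  funext p
  simp [translate]

theorem shift₁_eq_translate : shift₁ (A := A) = translate (1, 0) := by
  funext x p
  simp [shift₁, translate, Prod.add_def]

theorem shift₂_eq_translate : shift₂ (A := A) = translate (0, 1) := by
  funext x p
  simp [shift₂, translate, Prod.add_def]

theorem iterate_translate (v : ℤ × ℤ) (n : ℕ) (x : Config A) :
    (translate v)^[n] x = translate (n • v) x := by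
  induction n generalizing x with
  | zero => simp [translate_zero]
  | succ n ih => rw [Function.iterate_succ_apply, ih, translate_translate, succ_nsmul]

theorem iterate_shift₁_shift₂ (i j : ℕ) (x : Config A) :
    shift₁^[i] (shift₂^[j] x) = translate ((i : ℤ), (j : ℤ)) x := by
  rw [shift₁_eq_translate, shift₂_eq_translate, iterate_translate, iterate_translate,
    translate_translate]
  simp

variable [MeasurableSpace A]

theorem measurable_translate (v : ℤ × ℤ) : Measurable (translate (A := A) v) :=
  measurable_pi_lambda _ fun p => measurable_pi_apply (p + v)

theorem measurableFibers_rect {f : Config A → ι} (hf : MeasurableFibers f) (a b : ℕ) :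
    MeasurableFibers (fun x (q : Fin a × Fin b) =>
      f (translate (((q.1 : ℕ) : ℤ), ((q.2 : ℕ) : ℤ)) x)) :=
  MeasurableFibers.pi fun _ => hf.comp (measurable_translate _)

variable {μ : Measure (Config A)}

theorem IsShiftErgodic.measurePreserving_translate (hσ : IsShiftErgodic μ) (i j : ℕ) :
    MeasurePreserving (translate (A := A) ((i : ℤ), (j : ℤ))) μ μ := by
  have h := (hσ.measurePreserving₁.iterate i).comp (hσ.measurePreserving₂.iterate j)
  convert h using 1
  funext x
  simp [iterate_shift₁_shift₂]

variable [Fintype ι]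

/-- The entropy of the join of the translates of the partition `f` over the rectangle
`[0,a) × [0,b)`. -/
noncomputable def rectEntropy (μ : Measure (Config A)) (f : Config A → ι) (a b : ℕ) : ℝ :=
  partitionEntropy μ (fun x (q : Fin a × Fin b) =>
    f (translate (((q.1 : ℕ) : ℤ), ((q.2 : ℕ) : ℤ)) x))

theorem shiftEntropySeq_eq (f : Config A → ι) (n : ℕ) :
    shiftEntropySeq μ f n = rectEntropy μ f n n / (n : ℝ) ^ 2 := by
  simp only [shiftEntropySeq, rectEntropy, iterate_shift₁_shift₂]

variable [IsProbabilityMeasure μ]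

theorem rectEntropy_nonneg (f : Config A → ι) (a b : ℕ) : 0 ≤ rectEntropy μ f a b :=
  partitionEntropy_nonneg μ _

theorem rectEntropy_mono {f : Config A → ι} (hf : MeasurableFibers f) {a b a' b' : ℕ}
    (ha : a ≤ a') (hb : b ≤ b') : rectEntropy μ f a b ≤ rectEntropy μ f a' b' := by
  refine partitionEntropy_mono μ (measurableFibers_rect hf a' b') fun x y h => ?_
  funext q
  exact congrFun h (Fin.castLE ha q.1, Fin.castLE hb q.2)

theorem rectEntropy_add_left_le (hσ : IsShiftErgodic μ) {f : Config A → ι}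
    (hf : MeasurableFibers f) (a a' b : ℕ) :
    rectEntropy μ f (a + a') b ≤ rectEntropy μ f a b + rectEntropy μ f a' b := by
  have hT := hσ.measurePreserving_translate a 0
  unfold rectEntropy
  rw [← partitionEntropy_comp_eq μ (measurableFibers_rect hf a' b) hT]
  refine partitionEntropy_le_add μ (measurableFibers_rect hf a b)
    ((measurableFibers_rect hf a' b).comp hT.measurable) fun x y h1 h2 => ?_
  funext q
  rcases lt_or_ge (q.1 : ℕ) a with hq | hq
  · exact congrFun h1 (⟨q.1, hq⟩, q.2)
  · have := congrFun h2 (⟨q.1 - a, by omega⟩, q.2)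
    simp only [translate_translate, Prod.mk_add_mk, Nat.cast_sub hq] at this
    simpa using this

theorem rectEntropy_add_right_le (hσ : IsShiftErgodic μ) {f : Config A → ι}
    (hf : MeasurableFibers f) (a b b' : ℕ) :
    rectEntropy μ f a (b + b') ≤ rectEntropy μ f a b + rectEntropy μ f a b' := by
  have hT := hσ.measurePreserving_translate 0 b
  unfold rectEntropy
  rw [← partitionEntropy_comp_eq μ (measurableFibers_rect hf a b') hT]
  refine partitionEntropy_le_add μ (measurableFibers_rect hf a b)
    ((measurableFibers_rect hf a b').comp hT.measurable) fun x y h1 h2 => ?_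
  funext q
  rcases lt_or_ge (q.2 : ℕ) b with hq | hq
  · exact congrFun h1 (q.1, ⟨q.2, hq⟩)
  · have := congrFun h2 (q.1, ⟨q.2 - b, by omega⟩)
    simp only [translate_translate, Prod.mk_add_mk, Nat.cast_sub hq] at this
    simpa using this

theorem rectEntropy_mul_le (hσ : IsShiftErgodic μ) {f : Config A → ι}
    (hf : MeasurableFibers f) (a b k : ℕ) :
    rectEntropy μ f ((a + 1) * k) ((b + 1) * k) ≤ (a + 1) * (b + 1) * rectEntropy μ f k k := by
  have h1 : ∀ (c : ℕ) (a : ℕ),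
      rectEntropy μ f ((a + 1) * k) c ≤ (a + 1) * rectEntropy μ f k c := by
    intro c a
    induction a with
    | zero => simp
    | succ a ih =>
      rw [add_one_mul (a + 1) k]
      push_cast
      linarith [rectEntropy_add_left_le hσ hf ((a + 1) * k) k c]
  have h2 : ∀ (b : ℕ), rectEntropy μ f k ((b + 1) * k) ≤ (b + 1) * rectEntropy μ f k k := by
    intro b
    induction b with
    | zero => simp
    | succ b ih =>
      rw [add_one_mul (b + 1) k]
      push_cast
      linarith [rectEntropy_add_right_le hσ hf k ((b + 1) * k) k]
  refine (h1 _ a).trans ?_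
  rw [mul_assoc]
  exact mul_le_mul_of_nonneg_left (h2 b) (by positivity)

/-- The rectangle is covered by at most a/k + 1 columns and b/k + 1 rows of k × k squares, and
entropy is subadditive and translation invariant. -/
theorem rectEntropy_le (hσ : IsShiftErgodic μ) {f : Config A → ι}
    (hf : MeasurableFibers f) (a b : ℕ) {k : ℕ} (hk : 0 < k) :
    rectEntropy μ f a b ≤ (a / k + 1) * (b / k + 1) * rectEntropy μ f k k := by
  have hle : ∀ a : ℕ, a ≤ (a / k + 1) * k := fun a => (Nat.lt_div_mul_add hk).le.trans (by
    rw [add_one_mul])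
  refine (rectEntropy_mono hf (hle a) (hle b)).trans
    ((rectEntropy_mul_le hσ hf _ _ k).trans ?_)
  refine mul_le_mul_of_nonneg_right ?_ (rectEntropy_nonneg f k k)
  gcongr <;> exact Nat.cast_div_le

/-- Fekete's argument in two dimensions: tiling a large square by squares of a fixed side bounds the
limsup by each term, so the limit is the infimum. -/
theorem tendsto_shiftEntropySeq (hσ : IsShiftErgodic μ) {f : Config A → ι}
    (hf : MeasurableFibers f) :
    Tendsto (shiftEntropySeq μ f) atTop (𝓝 (shiftEntropyOf μ f)) := by
  refine tendsto_nhds_limUnder ?_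
  have hnn : ∀ n, 0 ≤ shiftEntropySeq μ f n := fun n => by
    rw [shiftEntropySeq_eq]
    exact div_nonneg (rectEntropy_nonneg f n n) (by positivity)
  -- The index 0 is left out: there the quotient is 0 by the convention for division by zero and
  -- would spoil the infimum.
  have hbdd : BddBelow (Set.range fun k : ℕ => shiftEntropySeq μ f (k + 1)) :=
    ⟨0, by rintro _ ⟨k, rfl⟩; exact hnn _⟩
  refine ⟨⨅ k : ℕ, shiftEntropySeq μ f (k + 1), ?_⟩
  rw [tendsto_order]
  constructor
  · intro c hc
    filter_upwards [eventually_gt_atTop 0] with n hn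
    obtain ⟨k, rfl⟩ := Nat.exists_eq_succ_of_ne_zero hn.ne'
    exact hc.trans_le (ciInf_le hbdd k)
  · intro c hc
    obtain ⟨k, hk⟩ := exists_lt_of_ciInf_lt hc
    have hlim : Tendsto (fun n : ℕ => (1 + (k + 1 : ℝ) / n) * (1 + (k + 1 : ℝ) / n) *
        shiftEntropySeq μ f (k + 1)) atTop (𝓝 ((1 + 0) * (1 + 0) *
        shiftEntropySeq μ f (k + 1))) := by
      have h0 : Tendsto (fun n : ℕ => (k + 1 : ℝ) / n) atTop (𝓝 0) :=
        tendsto_const_div_atTop_nhds_zero_nat _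
      exact ((h0.const_add 1).mul (h0.const_add 1)).mul_const _
    rw [add_zero, one_mul, one_mul] at hlim
    filter_upwards [hlim.eventually_lt_const hk, eventually_gt_atTop 0] with n hn hn0
    refine lt_of_le_of_lt ?_ hn
    rw [shiftEntropySeq_eq, shiftEntropySeq_eq]
    have hn0' : (0 : ℝ) < n := by exact_mod_cast hn0
    rw [div_le_iff₀ (by positivity)]
    refine (rectEntropy_le hσ hf n n (Nat.succ_pos k)).trans (le_of_eq ?_)
    push_cast
    field_simp

theorem shiftEntropyOf_nonneg (hσ : IsShiftErgodic μ) {f : Config A → ι}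
    (hf : MeasurableFibers f) : 0 ≤ shiftEntropyOf μ f :=
  ge_of_tendsto' (tendsto_shiftEntropySeq hσ hf) fun n => by
    rw [shiftEntropySeq_eq]
    exact div_nonneg (rectEntropy_nonneg f n n) (by positivity)

end Shift

/-! ### Dependence of functions on coordinates -/

/-- Pass from x to y through the configuration that equals x on s and y off s. -/
theorem _root_.DependsOn.inter {ι β : Type*} {α : ι → Type*} {f : (∀ i, α i) → β} {s t : Set ι}
    (hs : DependsOn f s) (ht : DependsOn f t) : DependsOn f (s ∩ t) := by
  classical
  intro x y h
  have h1 : f x = f (s.piecewise x y) := hs fun i hi => by simp [hi]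
  have h2 : f (s.piecewise x y) = f y := ht fun i hi => by
    by_cases his : i ∈ s
    · simpa [his] using h i ⟨his, hi⟩
    · simp [his]
  exact h1.trans h2

/-- Compactness, as in the Curtis–Hedlund–Lyndon theorem: f is constant on a cylinder around each
point, and finitely many cylinders cover the space. -/
theorem exists_finset_dependsOn_of_continuous {ι A B : Type*} [Finite A] [TopologicalSpace A]
    [DiscreteTopology A] [TopologicalSpace B] [DiscreteTopology B] {f : (ι → A) → B}
    (hf : Continuous f) : ∃ s : Finset ι, DependsOn f (s : Set ι) := by
  classical
  have h : ∀ x : ι → A, ∃ s : Finset ι, ∀ y, (∀ i ∈ s, y i = x i) → f y = f x := by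
    intro x
    have hx : f ⁻¹' {f x} ∈ 𝓝 x := hf.continuousAt.preimage_mem_nhds (by simp)
    rw [nhds_pi, Filter.mem_pi'] at hx
    obtain ⟨s, t, ht, hst⟩ := hx
    exact ⟨s, fun y hy => hst fun i hi => by rw [hy i hi]; exact mem_of_mem_nhds (ht i)⟩
  choose s hs using h
  have hopen : ∀ x ∈ (Set.univ : Set (ι → A)), {y : ι → A | ∀ i ∈ s x, y i = x i} ∈ 𝓝 x := by
    intro x _
    refine IsOpen.mem_nhds ?_ (by simp)
    have : {y : ι → A | ∀ i ∈ s x, y i = x i} = ⋂ i ∈ s x, (fun y => y i) ⁻¹' {x i} := by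
      ext; simp
    rw [this]
    exact isOpen_biInter_finset fun i _ => (isOpen_discrete _).preimage (continuous_apply i)
  obtain ⟨t, -, ht⟩ := isCompact_univ.elim_nhds_subcover _ hopen
  refine ⟨t.biUnion s, fun y z hyz => ?_⟩
  obtain ⟨x, hxt, hx⟩ := Set.mem_iUnion₂.1 (ht (Set.mem_univ y))
  rw [hs x y hx, hs x z fun i hi => ?_]
  rw [← hyz i (by simpa using ⟨x, hxt, hi⟩)]
  exact hx i hi

/-! ### Lattice half planes -/

/-- The scalar product of `p` with the unit vector of angle `θ`. -/
noncomputable def level (θ : ℝ) (p : ℤ × ℤ) : ℝ := p.1 * Real.cos θ + p.2 * Real.sin θ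

/-- The Euclidean length of a lattice vector. -/
noncomputable def len (p : ℤ × ℤ) : ℝ := Real.sqrt ((p.1 : ℝ) ^ 2 + (p.2 : ℝ) ^ 2)

theorem len_eq_norm (p : ℤ × ℤ) : len p = ‖(⟨p.1, p.2⟩ : ℂ)‖ := by
  rw [len, Complex.norm_def, Complex.normSq_mk]
  ring_nf

theorem len_nonneg (p : ℤ × ℤ) : 0 ≤ len p := Real.sqrt_nonneg _

theorem len_add_le (p q : ℤ × ℤ) : len (p + q) ≤ len p + len q := by
  simp only [len_eq_norm]
  have : (⟨(p + q).1, (p + q).2⟩ : ℂ) = ⟨p.1, p.2⟩ + ⟨q.1, q.2⟩ := by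
    apply Complex.ext <;> simp
  rw [this]
  exact norm_add_le _ _

/-- The square of `len p`, as a natural number. -/
def sqLen (p : ℤ × ℤ) : ℕ := p.1.natAbs ^ 2 + p.2.natAbs ^ 2

theorem len_eq_sqrt_sqLen (p : ℤ × ℤ) : len p = Real.sqrt (sqLen p : ℕ) := by
  have : ((sqLen p : ℕ) : ℝ) = (p.1 : ℝ) ^ 2 + (p.2 : ℝ) ^ 2 := by
    have : ((sqLen p : ℕ) : ℤ) = p.1 ^ 2 + p.2 ^ 2 := by
      simp [sqLen]
    exact_mod_cast this
  rw [this, len]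

theorem len_le_len_iff (p q : ℤ × ℤ) : len p ≤ len q ↔ sqLen p ≤ sqLen q := by
  rw [len_eq_sqrt_sqLen, len_eq_sqrt_sqLen, Real.sqrt_le_sqrt_iff (by positivity), Nat.cast_le]

theorem finite_setOf_len_le (c : ℝ) : {p : ℤ × ℤ | len p ≤ c}.Finite := by
  refine (Set.finite_Icc ((-⌈c⌉, -⌈c⌉) : ℤ × ℤ) (⌈c⌉, ⌈c⌉)).subset fun p hp => ?_
  have hp' : len p ≤ c := hp
  have h1 : |(p.1 : ℝ)| ≤ c := (Real.abs_le_sqrt (by nlinarith [sq_nonneg (p.2 : ℝ)])).trans hp'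
  have h2 : |(p.2 : ℝ)| ≤ c := (Real.abs_le_sqrt (by nlinarith [sq_nonneg (p.1 : ℝ)])).trans hp'
  have h1' : |p.1| ≤ ⌈c⌉ := by exact_mod_cast h1.trans (Int.le_ceil c)
  have h2' : |p.2| ≤ ⌈c⌉ := by exact_mod_cast h2.trans (Int.le_ceil c)
  rw [abs_le] at h1' h2'
  exact ⟨⟨h1'.1, h2'.1⟩, ⟨h1'.2, h2'.2⟩⟩

theorem level_add (θ : ℝ) (p q : ℤ × ℤ) : level θ (p + q) = level θ p + level θ q := by
  simp only [level, Prod.fst_add, Prod.snd_add, Int.cast_add]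
  ring

theorem level_zero (θ : ℝ) : level θ 0 = 0 := by simp [level]

theorem level_le_len (θ : ℝ) (p : ℤ × ℤ) : level θ p ≤ len p := by
  refine Real.le_sqrt_of_sq_le ?_
  have := Real.sin_sq_add_cos_sq θ
  have h2 := sq_nonneg ((p.1 : ℝ) * Real.sin θ - p.2 * Real.cos θ)
  have h3 : ((p.1 : ℝ) ^ 2 + (p.2 : ℝ) ^ 2) * (Real.sin θ ^ 2 + Real.cos θ ^ 2) =
    (p.1 : ℝ) ^ 2 + (p.2 : ℝ) ^ 2 := by rw [this, mul_one]
  simp only [level]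
  nlinarith

/-- Round (c + 1)(cos θ, sin θ) to the lattice: an error of at most 1/2 in each coordinate changes
the level by at most 1. -/
theorem exists_le_level_len_le (θ : ℝ) {c : ℝ} (hc : 0 ≤ c) :
    ∃ p : ℤ × ℤ, c ≤ level θ p ∧ len p ≤ c + 2 := by
  set u : ℝ := (c + 1) * Real.cos θ
  set v : ℝ := (c + 1) * Real.sin θ
  have hu := abs_le.1 (abs_sub_round u)
  have hv := abs_le.1 (abs_sub_round v)
  set d := u - round u with hd
  set e := v - round v with he
  have h1 := Real.sin_sq_add_cos_sq θ
  have hde : |d * Real.cos θ + e * Real.sin θ| ≤ 1 := by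
    have hD : |d * Real.cos θ| ≤ 1 / 2 := by
      rw [abs_mul]
      nlinarith [abs_le.2 hu, Real.abs_cos_le_one θ, abs_nonneg d, abs_nonneg (Real.cos θ)]
    have hE : |e * Real.sin θ| ≤ 1 / 2 := by
      rw [abs_mul]
      nlinarith [abs_le.2 hv, Real.abs_sin_le_one θ, abs_nonneg e, abs_nonneg (Real.sin θ)]
    linarith [abs_add_le (d * Real.cos θ) (e * Real.sin θ)]
  have hu' : (round u : ℝ) = u - d := by rw [hd]; ring
  have hv' : (round v : ℝ) = v - e := by rw [he]; ring
  have hde' := abs_le.1 hde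
  have hsum : u * Real.cos θ + v * Real.sin θ = c + 1 := by
    calc u * Real.cos θ + v * Real.sin θ
        = (c + 1) * (Real.sin θ ^ 2 + Real.cos θ ^ 2) := by ring
      _ = c + 1 := by rw [h1, mul_one]
  refine ⟨(round u, round v), ?_, ?_⟩
  · simp only [level, hu', hv']
    linarith
  · refine Real.sqrt_le_iff.2 ⟨by linarith, ?_⟩
    simp only [hu', hv']
    have hd2 : d ^ 2 ≤ 1 / 4 := by nlinarith
    have he2 : e ^ 2 ≤ 1 / 4 := by nlinarith
    have huv : u ^ 2 + v ^ 2 = (c + 1) ^ 2 := by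
      calc u ^ 2 + v ^ 2 = (c + 1) ^ 2 * (Real.sin θ ^ 2 + Real.cos θ ^ 2) := by ring
        _ = _ := by rw [h1, mul_one]
    have hx : u * d + v * e = (c + 1) * (d * Real.cos θ + e * Real.sin θ) := by ring
    nlinarith [mul_le_mul_of_nonneg_left hde'.1 (by linarith : 0 ≤ c + 1)]

/-- Each integer part lowers its coordinate by less than 1, and the weights cos θ and sin θ are at
least -1. -/
theorem level_le_of_mem_halfPlane {θ : ℝ} {p q : ℤ × ℤ} (h : q ∈ halfPlane θ p) :
    level θ q ≤ level θ p + 2 := by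
  obtain ⟨s, t, hst, rfl⟩ := h
  have hs : (⌊s⌋ : ℝ) = s - Int.fract s := (Int.self_sub_fract s).symm
  have ht : (⌊t⌋ : ℝ) = t - Int.fract t := (Int.self_sub_fract t).symm
  have h1 : -1 ≤ Int.fract s * Real.cos θ := by
    nlinarith [Int.fract_nonneg s, (Int.fract_lt_one s).le, Real.neg_one_le_cos θ]
  have h2 : -1 ≤ Int.fract t * Real.sin θ := by
    nlinarith [Int.fract_nonneg t, (Int.fract_lt_one t).le, Real.neg_one_le_sin θ]
  simp only [level, hs, ht]
  linarith

theorem mem_halfPlane_of_level_le {θ : ℝ} {p q : ℤ × ℤ} (h : level θ q ≤ level θ p) :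
    q ∈ halfPlane θ p :=
  ⟨q.1, q.2, h, by simp⟩

theorem halfPlane_subset_halfPlane {θ : ℝ} {p q : ℤ × ℤ} (h : level θ p ≤ level θ q) :
    halfPlane θ p ⊆ halfPlane θ q := by
  rintro _ ⟨s, t, hst, rfl⟩
  exact ⟨s, t, hst.trans h, rfl⟩

theorem add_mem_halfPlane_iff {θ : ℝ} {p q r : ℤ × ℤ} :
    r + q ∈ halfPlane θ (p + q) ↔ r ∈ halfPlane θ p := by
  constructor
  · rintro ⟨s, t, hst, h⟩
    refine ⟨s - q.1, t - q.2, ?_, ?_⟩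
    · simp only [Prod.fst_add, Prod.snd_add, Int.cast_add] at hst
      linarith
    · rw [eq_sub_of_add_eq h]
      ext <;> simp
  · rintro ⟨s, t, hst, rfl⟩
    refine ⟨s + q.1, t + q.2, ?_, ?_⟩
    · simp only [Prod.fst_add, Prod.snd_add, Int.cast_add]
      linarith
    · ext <;> simp

/-! ### Cellular automata -/

variable {A : Type*}

theorem IsCellularAutomaton.map_translate [TopologicalSpace A] {F : Config A → Config A}
    (hF : IsCellularAutomaton F) (v : ℤ × ℤ) (x : Config A) :
    F (translate v x) = translate v (F x) := by
  have key : ∀ w : ℤ × ℤ, (∀ x, F (translate w x) = translate w (F x)) →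
      ∀ (n : ℤ) (x), F (translate (n • w) x) = translate (n • w) (F x) := by
    intro w hw
    have hn : ∀ (n : ℕ) (x), F (translate (n • w) x) = translate (n • w) (F x) := by
      intro n
      induction n with
      | zero => simp [translate_zero]
      | succ n ih =>
        intro x
        rw [succ_nsmul, ← translate_translate, ih, hw, translate_translate]
    intro n x
    obtain ⟨n, rfl | rfl⟩ := n.eq_nat_or_neg
    · simpa using hn n x
    · have h := hn n (translate (-((n : ℤ) • w)) x)
      rw [translate_translate, natCast_zsmul, add_neg_cancel, translate_zero] at h
      rw [neg_smul, natCast_zsmul, h, translate_translate, neg_add_cancel, translate_zero]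
  have h1 := key (1, 0) (by simpa only [shift₁_eq_translate] using hF.comm₁)
  have h2 := key (0, 1) (by simpa only [shift₂_eq_translate] using hF.comm₂)
  have hv : v = v.1 • ((1, 0) : ℤ × ℤ) + v.2 • ((0, 1) : ℤ × ℤ) := by
    ext <;> simp
  rw [hv, ← translate_translate, h1, h2, translate_translate]

theorem IsCellularAutomaton.iterate_translate [TopologicalSpace A] {F : Config A → Config A}
    (hF : IsCellularAutomaton F) (k : ℕ) (v : ℤ × ℤ) (x : Config A) :
    F^[k] (translate v x) = translate v (F^[k] x) := by
  induction k generalizing x with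
  | zero => rfl
  | succ k ih => rw [Function.iterate_succ_apply, hF.map_translate, ih, Function.iterate_succ_apply]

theorem translate_apply_zero (v : ℤ × ℤ) (x : Config A) : translate v x 0 = x v := by
  simp [translate]

theorem IsCellularAutomaton.iterate_apply [TopologicalSpace A] {F : Config A → Config A}
    (hF : IsCellularAutomaton F) (k : ℕ) (v : ℤ × ℤ) (x : Config A) :
    F^[k] x v = F^[k] (translate v x) 0 := by
  rw [hF.iterate_translate, translate_apply_zero]

/-- The local rules of `F, …, F^n` read only coordinates in the half plane `level θ ≤ c`. -/
def RulesBelow (F : Config A → Config A) (n : ℕ) (θ c : ℝ) : Prop :=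
  ∀ k ≤ n, DependsOn (fun x => F^[k] x 0) {q | level θ q ≤ c}

/-- Agreement on the half plane through `p` propagates under `F, …, F^n` to agreement on the half
plane through the origin. -/
def Controls (F : Config A → Config A) (n : ℕ) (θ : ℝ) (p : ℤ × ℤ) (x : Config A) : Prop :=
  0 ≤ level θ p ∧ ∀ k ≤ n, ∀ y, (∀ q ∈ halfPlane θ p, y q = x q) →
    ∀ q ∈ halfPlane θ 0, F^[k] y q = F^[k] x q

theorem Controls.mono {F : Config A → Config A} {n : ℕ} {θ : ℝ} {p q : ℤ × ℤ} {x : Config A}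
    (h : Controls F n θ p x) (hpq : level θ p ≤ level θ q) : Controls F n θ q x :=
  ⟨h.1.trans hpq, fun k hk y hy =>
    h.2 k hk y fun r hr => hy r (halfPlane_subset_halfPlane hpq hr)⟩

/-- The case k = 0, included in `Controls`, is free because the half plane through p contains the
one through the origin. -/
theorem propagationRadii_eq (F : Config A → Config A) (n : ℕ) (θ : ℝ) (x : Config A) :
    propagationRadii F n θ x = len '' {p | Controls F n θ p x} := by
  ext s
  constructor
  · rintro ⟨p, hp, rfl, h⟩
    refine ⟨p, ⟨hp, fun k hk y hy q hq => ?_⟩, rfl⟩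
    rcases Nat.eq_zero_or_pos k with rfl | hk0
    · exact hy q (halfPlane_subset_halfPlane (by rw [level_zero]; exact hp) hq)
    · exact h k hk0 hk ⟨y, hy, rfl⟩ q hq
  · rintro ⟨p, ⟨hp, h⟩, rfl⟩
    refine ⟨p, hp, rfl, fun k _ hk => ?_⟩
    rintro _ ⟨y, hy, rfl⟩ q hq
    exact h k hk y hy q hq

theorem rulesBelow_of_controls {F : Config A → Config A} {n : ℕ} {θ : ℝ} {p : ℤ × ℤ}
    (h : ∀ x, Controls F n θ p x) : RulesBelow F n θ (level θ p + 2) :=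
  fun k hk x y hxy => ((h y).2 k hk x (fun q hq => hxy q (level_le_of_mem_halfPlane hq)) 0
    (mem_halfPlane_of_level_le le_rfl))

theorem lyapunov_periodic (F : Config A → Config A) :
    Function.Periodic (lyapunov F) (2 * Real.pi) := by
  intro θ
  have h : ∀ p, halfPlane (θ + 2 * Real.pi) p = halfPlane θ p := fun p => by
    simp only [halfPlane, Real.cos_add_two_pi, Real.sin_add_two_pi]
  have h2 : ∀ n x, propagationRadii F n (θ + 2 * Real.pi) x = propagationRadii F n θ x := by
    intro n x
    simp only [propagationRadii, agreeSet, h, Real.cos_add_two_pi, Real.sin_add_two_pi]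
  have h3 : ∀ n, propagationAt F n (θ + 2 * Real.pi) = propagationAt F n θ := fun n =>
    funext fun x => by rw [propagationAt, h2, propagationAt]
  simp only [lyapunov, propagation, h3]

/-! ### Propagation radii: existence, comparison with local rules, subadditivity -/

section Propagation

variable [TopologicalSpace A] {F : Config A → Config A}

theorem RulesBelow.controls (hF : IsCellularAutomaton F) {n : ℕ} {θ c : ℝ} {p : ℤ × ℤ}
    (h : RulesBelow F n θ c) (hp0 : 0 ≤ level θ p) (hp : c + 2 ≤ level θ p) (x : Config A) :
    Controls F n θ p x := by
  refine ⟨hp0, fun k hk y hy q hq => ?_⟩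
  rw [hF.iterate_apply k q y, hF.iterate_apply k q x]
  -- The half plane through the origin reaches level 2, which is why p needs level c + 2.
  refine h k hk fun r hr => hy _ (mem_halfPlane_of_level_le ?_)
  have h1 := level_le_of_mem_halfPlane hq
  rw [level_zero] at h1
  have h2 : level θ r ≤ c := hr
  rw [level_add]
  linarith

/-- The first n steps carry agreement from the half plane of p + q to that of p, by `hq` translated
by p; the remaining steps, at most m, carry it to the origin. -/
theorem controls_add (hF : IsCellularAutomaton F) {m n : ℕ} {θ : ℝ} {p q : ℤ × ℤ}
    (hp : ∀ x, Controls F m θ p x) (hq : ∀ x, Controls F n θ q x) (x : Config A) :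
    Controls F (m + n) θ (p + q) x := by
  refine ⟨by rw [level_add]; exact add_nonneg (hp x).1 (hq x).1, fun k hk y hy => ?_⟩
  have hn : ∀ j ≤ n, ∀ r ∈ halfPlane θ p, F^[j] y r = F^[j] x r := by
    intro j hj r hr
    have h := (hq (translate p x)).2 j hj (translate p y) (fun s hs => hy (s + p) (by
      rw [add_comm p q]; exact add_mem_halfPlane_iff.2 hs)) (r - p)
      (by rw [← add_mem_halfPlane_iff (q := p)]; simpa using hr)
    rw [hF.iterate_translate, hF.iterate_translate] at h
    simpa [translate] using h
  intro r hr
  rcases le_total k n with hkn | hkn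
  · exact hn k hkn r (halfPlane_subset_halfPlane (by rw [level_zero]; exact (hp x).1) hr)
  · obtain ⟨i, rfl⟩ := Nat.exists_eq_add_of_le' hkn
    rw [Function.iterate_add_apply, Function.iterate_add_apply]
    exact (hp (F^[n] x)).2 i (by omega) _ (hn n le_rfl) r hr

/-- One step reads a box of some radius R around each cell, so k steps read a box of radius Rk. -/
theorem exists_radius [Finite A] [DiscreteTopology A] (hF : IsCellularAutomaton F) :
    ∃ R : ℕ, ∀ k : ℕ, DependsOn (fun x => F^[k] x 0)
      {q | |q.1| ≤ (R * k : ℕ) ∧ |q.2| ≤ (R * k : ℕ)} := by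
  obtain ⟨s, hs⟩ := exists_finset_dependsOn_of_continuous
    ((continuous_apply (0 : ℤ × ℤ)).comp hF.continuous)
  obtain ⟨R, hR⟩ : ∃ R : ℕ, ∀ q ∈ s, |q.1| ≤ R ∧ |q.2| ≤ R := by
    refine ⟨s.sup fun q => max q.1.natAbs q.2.natAbs, fun q hq => ?_⟩
    have h := Finset.le_sup (f := fun q : ℤ × ℤ => max q.1.natAbs q.2.natAbs) hq
    simp only [max_le_iff] at h
    rw [Int.abs_eq_natAbs, Int.abs_eq_natAbs]
    exact ⟨by exact_mod_cast h.1, by exact_mod_cast h.2⟩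
  refine ⟨R, fun k => ?_⟩
  induction k with
  | zero =>
    intro x y h
    exact h 0 (by simp)
  | succ k ih =>
    intro x y h
    simp only [Function.iterate_succ_apply]
    refine ih fun q hq => ?_
    have hx := hF.iterate_apply 1 q
    simp only [Function.iterate_one] at hx
    rw [hx, hx]
    refine hs fun r hr => h (r + q) ?_
    have h1 := hR r hr
    obtain ⟨h3, h4⟩ := hq
    push_cast at h3 h4
    simp only [Set.mem_ofPred_eq, Prod.fst_add, Prod.snd_add, Nat.cast_mul, Nat.cast_add,
      Nat.cast_one]
    constructor
    · linarith [abs_add_le r.1 q.1]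
    · linarith [abs_add_le r.2 q.2]

theorem abs_level_sub_level_le (θ η : ℝ) (q : ℤ × ℤ) {c : ℝ} (h1 : |(q.1 : ℝ)| ≤ c)
    (h2 : |(q.2 : ℝ)| ≤ c) : |level θ q - level η q| ≤ 2 * c * |θ - η| := by
  have hc : |Real.cos θ - Real.cos η| ≤ |θ - η| := Real.abs_cos_sub_cos_le θ η
  have hs : |Real.sin θ - Real.sin η| ≤ |θ - η| := Real.abs_sin_sub_sin_le θ η
  have : level θ q - level η q =
      q.1 * (Real.cos θ - Real.cos η) + q.2 * (Real.sin θ - Real.sin η) := by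
    simp only [level]; ring
  rw [this]
  refine (abs_add_le _ _).trans ?_
  rw [abs_mul, abs_mul]
  have e1 := mul_le_mul h1 hc (abs_nonneg _) ((abs_nonneg _).trans h1)
  have e2 := mul_le_mul h2 hs (abs_nonneg _) ((abs_nonneg _).trans h1)
  linarith

variable [Finite A] [DiscreteTopology A]

theorem exists_rulesBelow (hF : IsCellularAutomaton F) :
    ∃ R : ℕ, ∀ n θ, RulesBelow F n θ (2 * (R * n : ℕ)) := by
  obtain ⟨R, hR⟩ := exists_radius hF
  refine ⟨R, fun n θ k hk => (hR k).mono fun q hq => ?_⟩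
  have hkn : ((R * k : ℕ) : ℝ) ≤ (R * n : ℕ) := by exact_mod_cast Nat.mul_le_mul_left R hk
  have h1 : |(q.1 : ℝ)| ≤ (R * k : ℕ) := by exact_mod_cast hq.1
  have h2 : |(q.2 : ℝ)| ≤ (R * k : ℕ) := by exact_mod_cast hq.2
  have h3 : q.1 * Real.cos θ ≤ |(q.1 : ℝ)| := (le_abs_self _).trans (by
    rw [abs_mul]; exact mul_le_of_le_one_right (abs_nonneg _) (Real.abs_cos_le_one θ))
  have h4 : q.2 * Real.sin θ ≤ |(q.2 : ℝ)| := (le_abs_self _).trans (by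
    rw [abs_mul]; exact mul_le_of_le_one_right (abs_nonneg _) (Real.abs_sin_le_one θ))
  simp only [Set.mem_ofPred_eq, level]
  linarith

theorem exists_controls (hF : IsCellularAutomaton F) (n : ℕ) (θ : ℝ) :
    ∃ p, ∀ x, Controls F n θ p x := by
  obtain ⟨R, hR⟩ := exists_rulesBelow hF
  obtain ⟨p, hp, -⟩ := exists_le_level_len_le θ
    (by positivity : (0 : ℝ) ≤ 2 * (R * n : ℕ) + 2)
  exact ⟨p, (hR n θ).controls hF (le_trans (by positivity) hp) hp⟩

/-- Squared lengths of lattice vectors are natural numbers, so a shortest controlling vector exists.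
-/
theorem isLeast_propagationAt (hF : IsCellularAutomaton F) (n : ℕ) (θ : ℝ) (x : Config A) :
    IsLeast (propagationRadii F n θ x) (propagationAt F n θ x) := by
  classical
  obtain ⟨p₀, hp₀⟩ := exists_controls hF n θ
  obtain ⟨p, hp, hmin⟩ := WellFounded.has_min (measure sqLen).wf {p | Controls F n θ p x}
    ⟨p₀, hp₀ x⟩
  have : IsLeast (propagationRadii F n θ x) (len p) := by
    rw [propagationRadii_eq]
    refine ⟨⟨p, hp, rfl⟩, ?_⟩
    rintro _ ⟨q, hq, rfl⟩
    exact (len_le_len_iff p q).2 (not_lt.1 (hmin q hq))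
  rwa [propagationAt, this.csInf_eq]

theorem propagationAt_le_len (hF : IsCellularAutomaton F) {n : ℕ} {θ : ℝ} {x : Config A}
    {p : ℤ × ℤ} (hp : Controls F n θ p x) : propagationAt F n θ x ≤ len p :=
  (isLeast_propagationAt hF n θ x).2 (by rw [propagationRadii_eq]; exact ⟨p, hp, rfl⟩)

theorem exists_controls_propagationAt (hF : IsCellularAutomaton F) (n : ℕ) (θ : ℝ)
    (x : Config A) : ∃ p, Controls F n θ p x ∧ len p = propagationAt F n θ x := by
  have := (isLeast_propagationAt hF n θ x).1
  rwa [propagationRadii_eq] at this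

/-- One vector controls every x, so all minima are lattice lengths below a common bound, and there
are finitely many of these. -/
theorem isGreatest_propagation [Nonempty A] (hF : IsCellularAutomaton F) (n : ℕ) (θ : ℝ) :
    IsGreatest (Set.range (propagationAt F n θ)) (propagation F n θ) := by
  obtain ⟨p₀, hp₀⟩ := exists_controls hF n θ
  have hfin : (Set.range (propagationAt F n θ)).Finite := by
    refine ((finite_setOf_len_le (len p₀)).image len).subset ?_
    rintro _ ⟨x, rfl⟩
    obtain ⟨p, -, hp⟩ := exists_controls_propagationAt hF n θ x
    exact ⟨p, hp.trans_le (propagationAt_le_len hF (hp₀ x)), hp⟩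
  have hne : (Set.range (propagationAt F n θ)).Nonempty := Set.range_nonempty _
  exact ⟨hne.csSup_mem hfin, fun s hs => le_csSup hfin.bddAbove hs⟩

variable [Nonempty A]

theorem propagation_le_len (hF : IsCellularAutomaton F) {n : ℕ} {θ : ℝ} {p : ℤ × ℤ}
    (hp : ∀ x, Controls F n θ p x) : propagation F n θ ≤ len p := by
  obtain ⟨x, hx⟩ := (isGreatest_propagation hF n θ).1
  exact hx ▸ propagationAt_le_len hF (hp x)

/-- Makes the choice uniform in x. Control only improves as the level grows, so among the finitely
many vectors of length at most Λ_n(θ) the one of highest level works for every x. -/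
theorem exists_controls_propagation (hF : IsCellularAutomaton F) (n : ℕ) (θ : ℝ) :
    ∃ p, (∀ x, Controls F n θ p x) ∧ len p = propagation F n θ := by
  have hle : ∀ x, propagationAt F n θ x ≤ propagation F n θ := fun x =>
    (isGreatest_propagation hF n θ).2 ⟨x, rfl⟩
  have hx : ∀ x, ∃ q, Controls F n θ q x ∧ len q ≤ propagation F n θ := fun x => by
    obtain ⟨q, hq, hq'⟩ := exists_controls_propagationAt hF n θ x
    exact ⟨q, hq, hq'.trans_le (hle x)⟩
  have hne : {p : ℤ × ℤ | len p ≤ propagation F n θ}.Nonempty :=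
    (hx (Classical.arbitrary _)).imp fun q hq => hq.2
  obtain ⟨p, hp, hmax⟩ := Set.exists_max_image _ (level θ) (finite_setOf_len_le _) hne
  have hc : ∀ x, Controls F n θ p x := fun x => by
    obtain ⟨q, hq, hq'⟩ := hx x
    exact hq.mono (hmax q hq')
  exact ⟨p, hc, le_antisymm hp (propagation_le_len hF hc)⟩

theorem propagation_nonneg (hF : IsCellularAutomaton F) (n : ℕ) (θ : ℝ) :
    0 ≤ propagation F n θ := by
  obtain ⟨p, -, hp⟩ := exists_controls_propagation hF n θ
  exact hp ▸ len_nonneg p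

theorem rulesBelow_propagation (hF : IsCellularAutomaton F) (n : ℕ) (θ : ℝ) :
    RulesBelow F n θ (propagation F n θ + 2) := by
  obtain ⟨p, hp, hp'⟩ := exists_controls_propagation hF n θ
  intro k hk
  refine (rulesBelow_of_controls hp k hk).mono fun q hq => ?_
  have h1 : level θ q ≤ level θ p + 2 := hq
  exact h1.trans (by linarith [level_le_len θ p])

/-- The constant 4 is 2 for the thickness of lattice half planes plus 2 for rounding to a lattice
vector. -/
theorem RulesBelow.propagation_le (hF : IsCellularAutomaton F) {n : ℕ} {θ c : ℝ}
    (h : RulesBelow F n θ c) (hc : 0 ≤ c) : propagation F n θ ≤ c + 4 := by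
  obtain ⟨p, hp, hp'⟩ := exists_le_level_len_le θ (by linarith : 0 ≤ c + 2)
  exact (propagation_le_len hF (h.controls hF (by linarith) hp)).trans (by linarith)

theorem subadditive_propagation (hF : IsCellularAutomaton F) (θ : ℝ) :
    Subadditive fun n => propagation F n θ := by
  intro m n
  obtain ⟨p, hp, hp'⟩ := exists_controls_propagation hF m θ
  obtain ⟨q, hq, hq'⟩ := exists_controls_propagation hF n θ
  simp only [← hp', ← hq']
  exact (propagation_le_len hF (controls_add hF hp hq)).trans (len_add_le p q)

/-! ### Directional Lyapunov exponents -/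

theorem tendsto_lyapunov (hF : IsCellularAutomaton F) (θ : ℝ) :
    Tendsto (fun n : ℕ => propagation F n θ / n) atTop (𝓝 (lyapunov F θ)) :=
  tendsto_nhds_limUnder ⟨_, (subadditive_propagation hF θ).tendsto_lim
    ⟨0, by rintro _ ⟨n, rfl⟩; exact div_nonneg (propagation_nonneg hF n θ) n.cast_nonneg⟩⟩

theorem lyapunov_nonneg (hF : IsCellularAutomaton F) (θ : ℝ) : 0 ≤ lyapunov F θ :=
  ge_of_tendsto' (tendsto_lyapunov hF θ) fun n =>
    div_nonneg (propagation_nonneg hF n θ) n.cast_nonneg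

/-- The levels in directions φ + t and φ - t add up to 2 cos t times the level in direction φ, so
the two outer half planes bound the middle one. The additive errors vanish after division by n. -/
theorem two_cos_mul_lyapunov_le (hF : IsCellularAutomaton F) (φ : ℝ) {t : ℝ}
    (ht : 0 < Real.cos t) :
    2 * Real.cos t * lyapunov F φ ≤ lyapunov F (φ + t) + lyapunov F (φ - t) := by
  have hlim : Tendsto (fun n : ℕ => propagation F n (φ + t) / n + propagation F n (φ - t) / n +
      (4 + 8 * Real.cos t) / n) atTop (𝓝 (lyapunov F (φ + t) + lyapunov F (φ - t) + 0)) :=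
    ((tendsto_lyapunov hF _).add (tendsto_lyapunov hF _)).add
      (tendsto_const_div_atTop_nhds_zero_nat _)
  rw [add_zero] at hlim
  refine le_of_tendsto_of_tendsto' ((tendsto_lyapunov hF φ).const_mul (2 * Real.cos t)) hlim ?_
  intro n
  have h1 := rulesBelow_propagation hF n (φ + t)
  have h2 := rulesBelow_propagation hF n (φ - t)
  have hn1 := propagation_nonneg hF n (φ + t)
  have hn2 := propagation_nonneg hF n (φ - t)
  set a := propagation F n (φ + t)
  set b := propagation F n (φ - t)
  have h3 : RulesBelow F n φ ((a + b + 4) / (2 * Real.cos t)) := by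
    intro k hk
    refine ((h1 k hk).inter (h2 k hk)).mono fun q hq => ?_
    have e1 : level (φ + t) q ≤ a + 2 := hq.1
    have e2 : level (φ - t) q ≤ b + 2 := hq.2
    have e3 : level (φ + t) q + level (φ - t) q = level φ q * (2 * Real.cos t) := by
      simp only [level, Real.cos_add, Real.cos_sub, Real.sin_add, Real.sin_sub]
      ring
    simp only [Set.mem_ofPred_eq]
    rw [le_div_iff₀ (by positivity)]
    linarith
  have h4 := h3.propagation_le hF (by positivity)
  have h5 : 2 * Real.cos t * propagation F n φ ≤ a + b + (4 + 8 * Real.cos t) := by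
    have := mul_le_mul_of_nonneg_left h4 (by positivity : 0 ≤ 2 * Real.cos t)
    have h6 : 2 * Real.cos t * ((a + b + 4) / (2 * Real.cos t) + 4) =
        a + b + (4 + 8 * Real.cos t) := by
      field_simp
      ring
    linarith
  rw [← mul_div_assoc, ← add_div, ← add_div]
  exact div_le_div_of_nonneg_right h5 n.cast_nonneg

/-- On the box of radius Rn that contains all coordinates read, turning the direction by δ changes
levels by at most 2Rn|δ|. -/
theorem exists_lipschitz_lyapunov (hF : IsCellularAutomaton F) :
    ∃ C : NNReal, LipschitzWith C (lyapunov F) := by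
  obtain ⟨R, hR⟩ := exists_radius hF
  refine ⟨2 * R, LipschitzWith.of_le_add_mul _ fun θ η => ?_⟩
  have hlim : Tendsto (fun n : ℕ => propagation F n η / n + 6 / n + 2 * R * |θ - η|) atTop
      (𝓝 (lyapunov F η + 0 + 2 * R * |θ - η|)) :=
    ((tendsto_lyapunov hF _).add (tendsto_const_div_atTop_nhds_zero_nat _)).add_const _
  rw [add_zero] at hlim
  rw [Real.dist_eq]
  push_cast
  refine le_of_tendsto_of_tendsto (tendsto_lyapunov hF θ) hlim ?_
  filter_upwards [eventually_gt_atTop 0] with n hn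
  have hn' : (0 : ℝ) < n := by exact_mod_cast hn
  have h1 := rulesBelow_propagation hF n η
  have h0 := propagation_nonneg hF n η
  have h2 : RulesBelow F n θ (propagation F n η + 2 + 2 * (R * n) * |θ - η|) := by
    intro k hk
    refine ((h1 k hk).inter (hR k)).mono fun q hq => ?_
    have hkn : ((R * k : ℕ) : ℝ) ≤ R * n := by exact_mod_cast Nat.mul_le_mul_left R hk
    have e1 : |(q.1 : ℝ)| ≤ (R * k : ℕ) := by exact_mod_cast hq.2.1
    have e2 : |(q.2 : ℝ)| ≤ (R * k : ℕ) := by exact_mod_cast hq.2.2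
    have e3 := abs_level_sub_level_le θ η q (e1.trans hkn) (e2.trans hkn)
    have e4 : level η q ≤ propagation F n η + 2 := hq.1
    simp only [Set.mem_ofPred_eq]
    linarith [le_abs_self (level θ q - level η q)]
  have h3 := h2.propagation_le hF (by positivity)
  rw [div_le_iff₀ hn']
  have : (propagation F n η / n + 6 / n + 2 * R * |θ - η|) * n =
      propagation F n η + 6 + 2 * (R * n) * |θ - η| := by
    field_simp
  linarith

theorem continuous_lyapunov (hF : IsCellularAutomaton F) : Continuous (lyapunov F) :=
  (exists_lipschitz_lyapunov hF).choose_spec.continuous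

end Propagation

/-! ### From the four axis exponents to the integral bound -/

section Integrals

variable {A : Type*} [Finite A] [Nonempty A] [TopologicalSpace A] [DiscreteTopology A]
  {F : Config A → Config A}

/-- Integrate `two_cos_mul_lyapunov_le` over |t| ≤ π/4, where cos has integral √2; both terms on the
right give the same integral. -/
theorem sqrt_two_mul_lyapunov_le_integral (hF : IsCellularAutomaton F) (φ : ℝ) :
    Real.sqrt 2 * lyapunov F φ ≤
      ∫ θ in (φ - Real.pi / 4)..(φ + Real.pi / 4), lyapunov F θ := by
  have hc := continuous_lyapunov hF
  have h1 : ∫ t in (-(Real.pi / 4))..(Real.pi / 4), lyapunov F (φ + t) =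
      ∫ θ in (φ - Real.pi / 4)..(φ + Real.pi / 4), lyapunov F θ := by
    rw [intervalIntegral.integral_comp_add_left (fun θ => lyapunov F θ) φ, sub_eq_add_neg]
  have h2 : ∫ t in (-(Real.pi / 4))..(Real.pi / 4), lyapunov F (φ - t) =
      ∫ θ in (φ - Real.pi / 4)..(φ + Real.pi / 4), lyapunov F θ := by
    rw [intervalIntegral.integral_comp_sub_left (fun θ => lyapunov F θ) φ, sub_neg_eq_add]
  have h3 : ∫ t in (-(Real.pi / 4))..(Real.pi / 4), 2 * Real.cos t * lyapunov F φ =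
      2 * (Real.sqrt 2 * lyapunov F φ) := by
    rw [intervalIntegral.integral_mul_const, intervalIntegral.integral_const_mul, integral_cos,
      Real.sin_neg, Real.sin_pi_div_four]
    ring
  have hpi := Real.pi_pos
  have c1 : Continuous fun t => lyapunov F (φ + t) := hc.comp (by fun_prop)
  have c2 : Continuous fun t => lyapunov F (φ - t) := hc.comp (by fun_prop)
  have h4 : ∫ t in (-(Real.pi / 4))..(Real.pi / 4), 2 * Real.cos t * lyapunov F φ ≤
      ∫ t in (-(Real.pi / 4))..(Real.pi / 4), (lyapunov F (φ + t) + lyapunov F (φ - t)) := by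
    refine intervalIntegral.integral_mono_on (by linarith)
      (Continuous.intervalIntegrable (by fun_prop) _ _)
      ((c1.add c2).intervalIntegrable _ _) fun t ht => ?_
    exact two_cos_mul_lyapunov_le hF φ
      (Real.cos_pos_of_mem_Ioo ⟨by linarith [ht.1], by linarith [ht.2]⟩)
  rw [intervalIntegral.integral_add (c1.intervalIntegrable _ _) (c2.intervalIntegrable _ _),
    h1, h2, h3] at h4
  linarith

/-- The four arcs of length π/2 centred at the axis directions tile one period, starting at -π/4. -/
theorem sqrt_two_mul_sum_le_integral_lyapunov (hF : IsCellularAutomaton F) :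
    Real.sqrt 2 * (lyapunov F 0 + lyapunov F Real.pi +
      (lyapunov F (Real.pi / 2) + lyapunov F (3 * Real.pi / 2))) ≤
      ∫ θ in (0 : ℝ)..(2 * Real.pi), lyapunov F θ := by
  have hi : ∀ a b : ℝ, IntervalIntegrable (lyapunov F) volume a b := fun a b =>
    (continuous_lyapunov hF).intervalIntegrable a b
  have hper := (lyapunov_periodic F).intervalIntegral_add_eq 0 (0 - Real.pi / 4)
  rw [zero_add] at hper
  have h0 := sqrt_two_mul_lyapunov_le_integral hF 0
  have h1 := sqrt_two_mul_lyapunov_le_integral hF (Real.pi / 2)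
  have h2 := sqrt_two_mul_lyapunov_le_integral hF Real.pi
  have h3 := sqrt_two_mul_lyapunov_le_integral hF (3 * Real.pi / 2)
  rw [show Real.pi / 2 - Real.pi / 4 = 0 + Real.pi / 4 by ring] at h1
  rw [show Real.pi - Real.pi / 4 = Real.pi / 2 + Real.pi / 4 by ring] at h2
  rw [show 3 * Real.pi / 2 - Real.pi / 4 = Real.pi + Real.pi / 4 by ring] at h3
  rw [hper, show 0 - Real.pi / 4 + 2 * Real.pi = 3 * Real.pi / 2 + Real.pi / 4 by ring,
    ← intervalIntegral.integral_add_adjacent_intervals (hi _ (Real.pi + Real.pi / 4)) (hi _ _),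
    ← intervalIntegral.integral_add_adjacent_intervals (hi _ (Real.pi / 2 + Real.pi / 4))
      (hi _ _),
    ← intervalIntegral.integral_add_adjacent_intervals (hi _ (0 + Real.pi / 4)) (hi _ _)]
  linarith

/-- On [0, π] the quadratic term is dropped. On [π, 2π] it is at least √2 λ - 1, from (λ - √2)² ≥ 0,
and the summand π pays for the integral of 1. -/
theorem sqrt_two_mul_integral_le_lyapunovBound (hF : IsCellularAutomaton F) :
    Real.sqrt 2 * ∫ θ in (0 : ℝ)..(2 * Real.pi), lyapunov F θ ≤ lyapunovBound F := by
  have hc := continuous_lyapunov hF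
  have hc2 : Continuous fun θ => lyapunov F θ ^ 2 / 2 := by fun_prop
  have hi : ∀ a b : ℝ, IntervalIntegrable (lyapunov F) volume a b := fun a b =>
    hc.intervalIntegrable a b
  have hi2 : ∀ a b : ℝ, IntervalIntegrable (fun θ => lyapunov F θ ^ 2 / 2) volume a b :=
    fun a b => hc2.intervalIntegrable a b
  have hpi := Real.pi_pos
  have h1 : 0 ≤ ∫ θ in (0 : ℝ)..Real.pi, lyapunov F θ ^ 2 / 2 :=
    intervalIntegral.integral_nonneg hpi.le fun _ _ => by positivity
  have h2 : ∫ θ in Real.pi..(2 * Real.pi), (Real.sqrt 2 * lyapunov F θ - 1) ≤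
      ∫ θ in Real.pi..(2 * Real.pi), lyapunov F θ ^ 2 / 2 := by
    refine intervalIntegral.integral_mono_on (by linarith)
      (((hi _ _).const_mul _).sub intervalIntegrable_const) (hi2 _ _) fun θ _ => ?_
    nlinarith [sq_nonneg (lyapunov F θ - Real.sqrt 2), Real.sq_sqrt (by norm_num : (0 : ℝ) ≤ 2)]
  rw [intervalIntegral.integral_sub ((hi _ _).const_mul _) intervalIntegrable_const,
    intervalIntegral.integral_const_mul, intervalIntegral.integral_const, smul_eq_mul] at h2
  rw [lyapunovBound,
    ← intervalIntegral.integral_add_adjacent_intervals (hi 0 Real.pi) (hi _ (2 * Real.pi)),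
    ← intervalIntegral.integral_add_adjacent_intervals (hi2 0 Real.pi) (hi2 _ (2 * Real.pi))]
  linarith

theorem two_mul_sum_lyapunov_le (hF : IsCellularAutomaton F) :
    2 * (lyapunov F 0 + lyapunov F Real.pi +
      (lyapunov F (Real.pi / 2) + lyapunov F (3 * Real.pi / 2))) ≤ lyapunovBound F := by
  refine le_trans ?_ (sqrt_two_mul_integral_le_lyapunovBound hF)
  have h := mul_le_mul_of_nonneg_left (sqrt_two_mul_sum_le_integral_lyapunov hF)
    (Real.sqrt_nonneg 2)
  rwa [← mul_assoc, Real.mul_self_sqrt (by norm_num)] at h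

/-- Intersects the half planes of the four axis directions. Each side lies at ⌈Λ + 2⌉ ≤ Λ + 3,
whence 6 for two opposite sides. -/
theorem exists_dependsOn_rect (hF : IsCellularAutomaton F) (m : ℕ) :
    ∃ l r d u : ℕ, (l + r : ℝ) ≤ propagation F m 0 + propagation F m Real.pi + 6 ∧
      (d + u : ℝ) ≤ propagation F m (Real.pi / 2) + propagation F m (3 * Real.pi / 2) + 6 ∧
      ∀ k ≤ m, DependsOn (fun x => F^[k] x 0)
        {q | (-l ≤ q.1 ∧ q.1 ≤ r) ∧ (-d ≤ q.2 ∧ q.2 ≤ u)} := by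
  have hn := fun θ => propagation_nonneg hF m θ
  have hceil : ∀ θ, (⌈propagation F m θ + 2⌉₊ : ℝ) ≤ propagation F m θ + 3 := fun θ => by
    have := Nat.ceil_lt_add_one (by linarith [hn θ] : 0 ≤ propagation F m θ + 2)
    linarith
  refine ⟨⌈propagation F m Real.pi + 2⌉₊, ⌈propagation F m 0 + 2⌉₊,
    ⌈propagation F m (3 * Real.pi / 2) + 2⌉₊, ⌈propagation F m (Real.pi / 2) + 2⌉₊,
    by linarith [hceil 0, hceil Real.pi],
    by linarith [hceil (Real.pi / 2), hceil (3 * Real.pi / 2)], fun k hk => ?_⟩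
  have hr := fun θ => rulesBelow_propagation hF m θ k hk
  refine (((hr 0).inter (hr Real.pi)).inter
    ((hr (Real.pi / 2)).inter (hr (3 * Real.pi / 2)))).mono ?_
  rintro q ⟨⟨h0, hπ⟩, ⟨hu, hd⟩⟩
  have hc : Real.cos (3 * Real.pi / 2) = 0 := by
    rw [show 3 * Real.pi / 2 = Real.pi / 2 + Real.pi by ring, Real.cos_add_pi]; simp
  have hs : Real.sin (3 * Real.pi / 2) = -1 := by
    rw [show 3 * Real.pi / 2 = Real.pi / 2 + Real.pi by ring, Real.sin_add_pi]; simp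
  simp only [Set.mem_ofPred_eq, level, Real.cos_zero, Real.sin_zero, Real.cos_pi, Real.sin_pi,
    Real.cos_pi_div_two, Real.sin_pi_div_two, hc, hs] at h0 hπ hu hd
  have cast_le : ∀ (z : ℤ) (θ : ℝ), (z : ℝ) ≤ propagation F m θ + 2 →
      z ≤ (⌈propagation F m θ + 2⌉₊ : ℕ) := fun z θ hz => by
    exact_mod_cast hz.trans (Nat.le_ceil _)
  have e1 := cast_le q.1 0 (by linarith)
  have e2 := cast_le (-q.1) Real.pi (by push_cast; linarith)
  have e3 := cast_le q.2 (Real.pi / 2) (by linarith)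
  have e4 := cast_le (-q.2) (3 * Real.pi / 2) (by push_cast; linarith)
  exact ⟨⟨by linarith, e1⟩, ⟨by linarith, e3⟩⟩

end Integrals

/-! ### The entropy bound -/

section Bound

variable {A : Type*} [MeasurableSpace A] [MeasurableSingletonClass A]

theorem measurableFibers_centralPartition :
    MeasurableFibers (centralPartition (A := A)) :=
  fun b => measurable_pi_apply ((0, 0) : ℤ × ℤ) (measurableSet_singleton b)

theorem measurableFibers_squarePartition (n : ℕ) :
    MeasurableFibers (squarePartition (A := A) n) :=
  MeasurableFibers.pi fun q b => measurable_pi_apply ((((q.1 : ℕ) : ℤ), ((q.2 : ℕ) : ℤ)) : ℤ × ℤ)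
    (measurableSet_singleton b)

variable [Fintype A] {μ : Measure (Config A)} [IsProbabilityMeasure μ]

/-- The supremum runs over maps into `Fin m`, so the alphabet is relabelled; entropy sees only the
fibres. -/
theorem shiftEntropyOf_centralPartition_le :
    ((shiftEntropyOf μ (centralPartition (A := A)) : ℝ) : EReal) ≤ shiftEntropy μ := by
  let e := Fintype.equivFin A
  have hf : Measurable fun x : Config A => e (centralPartition x) :=
    (measurable_of_finite e).comp (measurable_pi_apply ((0, 0) : ℤ × ℤ))
  have heq : shiftEntropyOf μ (centralPartition (A := A)) =
      shiftEntropyOf μ fun x : Config A => e (centralPartition x) := by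
    unfold shiftEntropyOf
    congr 1
    funext n
    rw [shiftEntropySeq_eq, shiftEntropySeq_eq]
    congr 1
    refine partitionEntropy_congr μ (measurableFibers_rect measurableFibers_centralPartition _ _)
      (measurableFibers_rect (fun b => hf (measurableSet_singleton b)) _ _) fun x y => ?_
    simp only [funext_iff, EmbeddingLike.apply_eq_iff_eq]
  rw [heq]
  exact le_iSup₂_of_le (Fintype.card A) ⟨_, hf⟩ le_rfl

variable [TopologicalSpace A] {F : Config A → Config A}

theorem entropySeq_le_rectEntropy (hF : IsCellularAutomaton F) (hσ : IsShiftErgodic μ)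
    (hμF : MeasurePreserving F μ μ) {m l r d u : ℕ}
    (h : ∀ k ≤ m, DependsOn (fun x => F^[k] x 0)
      {q | (-l ≤ q.1 ∧ q.1 ≤ r) ∧ (-d ≤ q.2 ∧ q.2 ≤ u)}) (n : ℕ) :
    entropySeq μ F (squarePartition n) m ≤
      rectEntropy μ centralPartition (n + 1 + (l + r)) (n + 1 + (d + u)) / m := by
  refine div_le_div_of_nonneg_right ?_ m.cast_nonneg
  have hm : MeasurableFibers fun x (k : Fin m) => squarePartition n (F^[(k : ℕ)] x) :=
    MeasurableFibers.pi fun k : Fin m =>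
      (measurableFibers_squarePartition n).comp (hμF.measurable.iterate (k : ℕ))
  -- Translation by (l, d) moves the window [-l, n + r] × [-d, n + u] to the rectangle with corner
  -- at the origin.
  rw [← partitionEntropy_comp_eq μ hm (hσ.measurePreserving_translate l d)]
  refine partitionEntropy_mono μ (measurableFibers_rect measurableFibers_centralPartition _ _)
    fun x y hxy => ?_
  have hxy' : ∀ i j : ℤ, 0 ≤ i → i < n + 1 + (l + r) → 0 ≤ j → j < n + 1 + (d + u) →
      x (i, j) = y (i, j) := by
    intro i j hi hi' hj hj'
    obtain ⟨i, rfl⟩ := Int.eq_ofNat_of_zero_le hi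
    obtain ⟨j, rfl⟩ := Int.eq_ofNat_of_zero_le hj
    have := congrFun hxy (⟨i, by omega⟩, ⟨j, by omega⟩)
    simpa [centralPartition, translate, Prod.add_def] using this
  funext k q
  have h1 := q.1.isLt
  have h2 := q.2.isLt
  simp only [squarePartition]
  rw [hF.iterate_apply, hF.iterate_apply (x := translate _ y)]
  refine h k k.isLt.le fun v hv => ?_
  obtain ⟨⟨a1, a2⟩, a3, a4⟩ := hv
  simp only [translate, Prod.add_def]
  exact hxy' _ _ (by omega) (by omega) (by omega) (by omega)

variable [DiscreteTopology A]

/-- The strict bounds absorb all additive constants for large m and make w positive, so that m ≈ n/w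
is possible even if the exponents vanish. -/
theorem alwaysFiniteEntropy_le_of_lt (hF : IsCellularAutomaton F) (hσ : IsShiftErgodic μ)
    (hμF : MeasurePreserving F μ μ) {w h : ℝ} (hw : lyapunov F 0 + lyapunov F Real.pi < w)
    (hh : lyapunov F (Real.pi / 2) + lyapunov F (3 * Real.pi / 2) < h) {k : ℕ} (hk : 0 < k) :
    alwaysFiniteEntropy μ F ≤
      ((2 * (w + h) * shiftEntropySeq μ (centralPartition (A := A)) k : ℝ) : EReal) := by
  have : Nonempty (Config A) := nonempty_of_isProbabilityMeasure μ
  have : Nonempty A := this.map fun x => x 0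
  have hw0 : 0 < w := lt_of_le_of_lt
    (add_nonneg (lyapunov_nonneg hF 0) (lyapunov_nonneg hF Real.pi)) hw
  have hk' : (0 : ℝ) < k := by exact_mod_cast hk
  -- Here 7 is the 6 of `exists_dependsOn_rect` plus 1, since 0, …, n are n + 1 coordinates.
  have ev : ∀ (θ η c : ℝ), lyapunov F θ + lyapunov F η < c →
      ∀ᶠ m : ℕ in atTop, propagation F m θ + propagation F m η + 7 ≤ c * m := by
    intro θ η c hc
    have hlim := ((tendsto_lyapunov hF θ).add (tendsto_lyapunov hF η)).add
      (tendsto_const_div_atTop_nhds_zero_nat (7 : ℝ))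
    rw [add_zero] at hlim
    filter_upwards [hlim.eventually_lt_const hc, eventually_gt_atTop 0] with m hm hm0
    have hm0' : (0 : ℝ) < m := by exact_mod_cast hm0
    rw [← add_div, ← add_div, div_lt_iff₀ hm0'] at hm
    exact hm.le
  set M : ℕ → ℕ := fun n => ⌈w⁻¹ * (n : ℝ)⌉₊ with hM
  have hMn : Tendsto (fun n : ℕ => (M n : ℝ) / n) atTop (𝓝 w⁻¹) :=
    (tendsto_nat_ceil_mul_div_atTop (inv_pos.2 hw0).le).comp tendsto_natCast_atTop_atTop
  have hMtop : Tendsto M atTop atTop := tendsto_nat_ceil_atTop.comp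
    (tendsto_natCast_atTop_atTop.const_mul_atTop (inv_pos.2 hw0))
  have hnM : Tendsto (fun n : ℕ => (n : ℝ) / M n) atTop (𝓝 w) := by
    have := hMn.inv₀ (inv_pos.2 hw0).ne'
    simpa only [inv_div, inv_inv] using this
  have hkn : Tendsto (fun n : ℕ => (k : ℝ) / n) atTop (𝓝 0) :=
    tendsto_const_div_atTop_nhds_zero_nat _
  -- This is the tiling bound for the rectangle with sides n + wM and n + hM, divided by nM.
  have hlim : Tendsto (fun n : ℕ => (1 + w * ((M n : ℝ) / n) + k / n) *
      ((n : ℝ) / M n + h + k / M n) * shiftEntropySeq μ (centralPartition (A := A)) k) atTop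
      (𝓝 (2 * (w + h) * shiftEntropySeq μ (centralPartition (A := A)) k)) := by
    have := ((((hMn.const_mul w).const_add 1).add hkn).mul
      ((hnM.add_const h).add (hkn.comp hMtop))).mul_const
      (shiftEntropySeq μ (centralPartition (A := A)) k)
    rwa [mul_inv_cancel₀ hw0.ne', add_zero, add_zero, one_add_one_eq_two] at this
  rw [alwaysFiniteEntropy, ← ((continuous_coe_real_ereal.tendsto _).comp hlim).liminf_eq]
  refine liminf_le_liminf ?_
  filter_upwards [hMtop.eventually (ev _ _ _ hw), hMtop.eventually (ev _ _ _ hh),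
    hMtop.eventually (eventually_gt_atTop 0), eventually_gt_atTop 0] with n e1 e2 e3 e4
  simp only [Function.comp_apply, EReal.coe_le_coe_iff]
  obtain ⟨l, r, d, u, hlr, hdu, hdep⟩ := exists_dependsOn_rect hF (M n)
  have hn : (0 : ℝ) < n := by exact_mod_cast e4
  have hMpos : (0 : ℝ) < M n := by exact_mod_cast e3
  have hH := rectEntropy_nonneg (μ := μ) (centralPartition (A := A)) k k
  have b1 : ((n + 1 + (l + r) : ℕ) : ℝ) ≤ n + w * M n := by push_cast; linarith
  have b2 : ((n + 1 + (d + u) : ℕ) : ℝ) ≤ n + h * M n := by push_cast; linarith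
  calc entropyOf μ F (squarePartition n) / n
      ≤ rectEntropy μ centralPartition (n + 1 + (l + r)) (n + 1 + (d + u)) / M n / n := by
        refine div_le_div_of_nonneg_right ?_ hn.le
        exact (entropyOf_le_entropySeq hμF (measurableFibers_squarePartition n) e3.ne').trans
          (entropySeq_le_rectEntropy hF hσ hμF hdep n)
    _ ≤ ((n + w * M n) / k + 1) * ((n + h * M n) / k + 1) *
          rectEntropy μ (centralPartition (A := A)) k k / M n / n := by
        refine div_le_div_of_nonneg_right (div_le_div_of_nonneg_right ?_ hMpos.le) hn.le
        refine (rectEntropy_le hσ measurableFibers_centralPartition _ _ hk).trans ?_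
        refine mul_le_mul_of_nonneg_right ?_ hH
        have c1 := div_le_div_of_nonneg_right b1 hk'.le
        have c2 := div_le_div_of_nonneg_right b2 hk'.le
        have c3 : 0 ≤ ((n + 1 + (d + u) : ℕ) : ℝ) / k := by positivity
        have c4 : 0 ≤ ((n + 1 + (l + r) : ℕ) : ℝ) / k := by positivity
        exact mul_le_mul (by linarith) (by linarith) (by linarith) (by linarith)
    _ = _ := by
        rw [shiftEntropySeq_eq]
        field_simp

theorem alwaysFiniteEntropy_le (hF : IsCellularAutomaton F) (hσ : IsShiftErgodic μ)
    (hμF : MeasurePreserving F μ μ) :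
    alwaysFiniteEntropy μ F ≤
      ((shiftEntropyOf μ (centralPartition (A := A)) * lyapunovBound F : ℝ) : EReal) := by
  have : Nonempty (Config A) := nonempty_of_isProbabilityMeasure μ
  have : Nonempty A := this.map fun x => x 0
  have hone : Tendsto (fun j : ℕ => 1 / ((j : ℝ) + 1)) atTop (𝓝 0) :=
    tendsto_one_div_add_atTop_nhds_zero_nat
  set w := lyapunov F 0 + lyapunov F Real.pi with hw
  set h := lyapunov F (Real.pi / 2) + lyapunov F (3 * Real.pi / 2) with hh
  have hL := shiftEntropyOf_nonneg hσ (measurableFibers_centralPartition (A := A))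
  have hlim : Tendsto (fun j : ℕ => 2 * ((w + 1 / ((j : ℝ) + 1)) + (h + 1 / ((j : ℝ) + 1))) *
      shiftEntropySeq μ (centralPartition (A := A)) (j + 1)) atTop
      (𝓝 (2 * ((w + 0) + (h + 0)) * shiftEntropyOf μ (centralPartition (A := A)))) :=
    (((hone.const_add w).add (hone.const_add h)).const_mul 2).mul
      ((tendsto_shiftEntropySeq hσ measurableFibers_centralPartition).comp
        (tendsto_add_atTop_nat 1))
  have hle : alwaysFiniteEntropy μ F ≤
      ((2 * ((w + 0) + (h + 0)) * shiftEntropyOf μ (centralPartition (A := A)) : ℝ) : EReal) := by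
    -- The slack 1/(j + 1) and the tile side j + 1 go to their limits together.
    refine ge_of_tendsto' ((continuous_coe_real_ereal.tendsto _).comp hlim) fun j => ?_
    have hj : (0 : ℝ) < 1 / ((j : ℝ) + 1) := by positivity
    exact alwaysFiniteEntropy_le_of_lt hF hσ hμF (by linarith) (by linarith) (Nat.succ_pos j)
  refine hle.trans (EReal.coe_le_coe_iff.2 ?_)
  rw [add_zero, add_zero, mul_comm (shiftEntropyOf μ _)]
  exact mul_le_mul_of_nonneg_right (two_mul_sum_lyapunov_le hF) hL

end Bound

end CA2D

theorem theorem1 {A : Type*} [Fintype A] [TopologicalSpace A] [DiscreteTopology A]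
    [MeasurableSpace A] [MeasurableSingletonClass A]
    (F : CA2D.Config A → CA2D.Config A) (hF : CA2D.IsCellularAutomaton F)
    (μ : Measure (CA2D.Config A)) [IsProbabilityMeasure μ]
    (hσ : CA2D.IsShiftErgodic μ) (hμF : MeasurePreserving F μ μ) :
    -- the limits, minima and maxima that define the quantities exist, and `λ` is continuous
    (∀ n : ℕ, Tendsto (CA2D.entropySeq μ F (CA2D.squarePartition n)) atTop
      (𝓝 (CA2D.entropyOf μ F (CA2D.squarePartition n)))) ∧
    (∀ (m : ℕ) (f : CA2D.Config A → Fin m), Measurable f →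
      Tendsto (CA2D.shiftEntropySeq μ f) atTop (𝓝 (CA2D.shiftEntropyOf μ f))) ∧
    (∀ (n : ℕ) (θ : ℝ) (x : CA2D.Config A),
      IsLeast (CA2D.propagationRadii F n θ x) (CA2D.propagationAt F n θ x)) ∧
    (∀ (n : ℕ) (θ : ℝ),
      IsGreatest (Set.range (CA2D.propagationAt F n θ)) (CA2D.propagation F n θ)) ∧
    (∀ θ : ℝ, Tendsto (fun n : ℕ => CA2D.propagation F n θ / n) atTop
      (𝓝 (CA2D.lyapunov F θ))) ∧
    Continuous (CA2D.lyapunov F) ∧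
    -- the inequality, with the entropy of the central partition and with that of the action
    CA2D.alwaysFiniteEntropy μ F ≤
      ((CA2D.shiftEntropyOf μ (CA2D.centralPartition (A := A)) * CA2D.lyapunovBound F : ℝ) :
        EReal) ∧
    CA2D.alwaysFiniteEntropy μ F ≤
      CA2D.shiftEntropy μ * ((CA2D.lyapunovBound F : ℝ) : EReal) := by
  have : Nonempty (CA2D.Config A) := nonempty_of_isProbabilityMeasure μ
  have : Nonempty A := this.map fun x => x 0
  have hbound := CA2D.alwaysFiniteEntropy_le hF hσ hμF
  refine ⟨fun n => CA2D.tendsto_entropySeq hμF (CA2D.measurableFibers_squarePartition n),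
    fun m f hf => CA2D.tendsto_shiftEntropySeq hσ fun b => hf (measurableSet_singleton b),
    CA2D.isLeast_propagationAt hF, CA2D.isGreatest_propagation hF, CA2D.tendsto_lyapunov hF,
    CA2D.continuous_lyapunov hF, hbound, hbound.trans ?_⟩
  -- The sign is needed to multiply `shiftEntropyOf_centralPartition_le` by the bound.
  have hnonneg : 0 ≤ CA2D.lyapunovBound F := by
    refine le_trans ?_ (CA2D.two_mul_sum_lyapunov_le hF)
    have := CA2D.lyapunov_nonneg hF
    linarith [this 0, this Real.pi, this (Real.pi / 2), this (3 * Real.pi / 2)]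
  rw [EReal.coe_mul]
  exact mul_le_mul_of_nonneg_right CA2D.shiftEntropyOf_centralPartition_le
    (EReal.coe_nonneg.2 hnonneg)
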